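/- Let $P$ be a deflated polygon: a simple polygon in the plane such that, when every pair of distinct vertices that see each other (the closed segment joining them is contained in the closed polygon) is joined by the open segment between them, no two of these open segments intersect. Let $T$ be the triangulation of $P$ (the partition of $P$ into triangles whose corners are vertices of $P$). A vertex $u$ and a polygon edge $g$ (taken without its endpoints) are \emph{visible} if some closed segment contained in the closed polygon joins $u$ to a point of $g$. The \emph{directed dual} $D$ of $T$ is the plane tree with a triangle node for each triangle of $T$ and a terminal node $g^D$ for each polygon edge $g$; two nodes are adjacent if their triangles/edges share an edge, and the neighbours of a triangle node are in the counter-clockwise order of the corresponding edges of the triangle. For adjacent triangles $a,b$ the edge of $D$ joining them is directed $a\to b$ if the quadrilateral $a\cup b$ has a reflex vertex lying to the right when one goes straight from $a$ to $b$ inside the quadrilateral. A \emph{visibility path} in $D$ is a sequence of nodes $(x_1,\dots,x_k)$, $k\ge 2$, where $x_1$ is a triangle node adjacent to $x_2$ and, for each $i\ge 2$: if $x_i$ is a terminal node then $i=k$; otherwise $i<k$ and, if $x_{i-1}, r, \ell$ are the neighbours of $x_i$ in counter-clockwise order, $x_{i+1}=r$ if the edge $\{x_{i-1},x_i\}$ is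 directed $x_{i-1}\leftarrow x_i$, and $x_{i+1}=\ell$ if it is directed $x_{i-1}\to x_i$. Then: (1) A vertex $u$ and an edge $g$ of $P$ are visible if and only if $D$ contains a visibility path that starts at the triangle node of a triangle having $u$ as a corner and ends at $g^D$. (2) Consequently the vertex-edge visibility graph of $P$ is determined by $D$: if $P'$ is another deflated polygon, with directed dual $D'$, and $\varphi\colon D\to D'$ is an isomorphism of directed duals (a bijection of the nodes preserving the two kinds of nodes, adjacency, the counter-clockwise order of neighbours and the directions of edges), then there are bijections $\sigma$ from the vertices of $P$ to those of $P'$ and $\tau$ from the edges of $P$ to those of $P'$ such that $\varphi(g^D)=\tau(g)^{D'}$ for every edge $g$; $u$ is an endpoint of $g$ if and only if $\sigma(u)$ is an endpoint of $\tau(g)$; and $u$ and $g$ are visible in $P$ if and only if $\sigma(u)$ and $\tau(g)$ are visible in $P'$. -/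

import Mathlib

namespace PolyVis

/-- The Euclidean plane. -/
abbrev Plane : Type := EuclideanSpace ℝ (Fin 2)

/-- Twice the signed area of the triangle `p q r`. It is positive iff `(p, q, r)` is a left turn,
i.e. iff `p, q, r` is the counter-clockwise order of the corners of a nondegenerate triangle, and
it is negative iff `(p, q, r)` is a right turn. -/
def orient (p q r : Plane) : ℝ :=
  (q 0 - p 0) * (r 1 - p 1) - (q 1 - p 1) * (r 0 - p 0)

/-! ### Simple polygons and visibility

A polygon has vertices `P i`, `i : Fin n`, and edges `P.edgeSet ℝ i`, the segment from `P i` to the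
cyclically next vertex `P (finRotate n i)`; edge number `i` is referred to by its index `i`. -/

/-- A simple polygon: at least three vertices, pairwise distinct, and two different edges meet at
most in a common endpoint. -/
structure IsSimple {n : ℕ} (P : Polygon Plane n) : Prop where
  three_le : 3 ≤ n
  injective : Function.Injective P.vertices
  edges_meet : ∀ i j : Fin n, i ≠ j → ∀ x ∈ P.edgeSet ℝ i ∩ P.edgeSet ℝ j,
    ∃ k : Fin n, x = P k ∧ (k = i ∨ k = finRotate n i) ∧ (k = j ∨ k = finRotate n j)

/-- The open polygon: the points enclosed by the boundary curve, i.e. the points off the boundary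
that lie in a bounded connected component of its complement. -/
def openRegion {n : ℕ} (P : Polygon Plane n) : Set Plane :=
  {x | x ∉ P.boundary ℝ ∧ Bornology.IsBounded (connectedComponentIn (P.boundary ℝ)ᶜ x)}

/-- The closed polygon: the boundary curve together with the open polygon. -/
def closedRegion {n : ℕ} (P : Polygon Plane n) : Set Plane :=
  P.boundary ℝ ∪ openRegion P

/-- The visibility graph: two different vertices are joined if the closed segment between them is
contained in the closed polygon. -/
def visibilityGraph {n : ℕ} (P : Polygon Plane n) : SimpleGraph (Fin n) where
  Adj u v := u ≠ v ∧ segment ℝ (P u) (P v) ⊆ closedRegion P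
  symm := ⟨fun u v h => ⟨h.1.symm, by rw [segment_symm]; exact h.2⟩⟩
  loopless := ⟨fun _ h => h.1 rfl⟩

/-- Vertex `u` and edge `g` are visible: a closed segment contained in the closed polygon joins
the vertex to a point of the edge. An edge is taken without its endpoints, so that seeing an
endpoint of an edge is not yet seeing the edge. -/
def SeesEdge {n : ℕ} (P : Polygon Plane n) (u g : Fin n) : Prop :=
  ∃ p ∈ openSegment ℝ (P g) (P (finRotate n g)), segment ℝ (P u) p ⊆ closedRegion P

/-- A deflated polygon: a simple polygon such that different edges of its visibility graph, drawn
as open segments, do not intersect. -/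
structure IsDeflated {n : ℕ} (P : Polygon Plane n) : Prop where
  simple : IsSimple P
  no_crossing : ∀ u v u' v' : Fin n, (visibilityGraph P).Adj u v → (visibilityGraph P).Adj u' v' →
    s(u, v) ≠ s(u', v') → Disjoint (openSegment ℝ (P u) (P v)) (openSegment ℝ (P u') (P v'))

/-! ### Triangulations -/

/-- The closed triangle spanned by a set of vertices. -/
def hull {n : ℕ} (P : Polygon Plane n) (t : Finset (Fin n)) : Set Plane :=
  convexHull ℝ (P.vertices '' (t : Set (Fin n)))

/-- `T` is a triangulation of `P`: each member of `T` is the set of the three corners of a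
nondegenerate triangle, these triangles cover the closed polygon and nothing more, and different
ones have disjoint interiors. -/
structure IsTriangulation {n : ℕ} (P : Polygon Plane n) (T : Finset (Finset (Fin n))) : Prop where
  card_eq : ∀ t ∈ T, t.card = 3
  nondegenerate : ∀ t ∈ T, (interior (hull P t)).Nonempty
  cover : ⋃ t ∈ T, hull P t = closedRegion P
  disjoint : ∀ t ∈ T, ∀ t' ∈ T, t ≠ t' → Disjoint (interior (hull P t)) (interior (hull P t'))

/-! ### Partially directed plane trees and their visibility paths -/

/-- The data of a partially directed plane tree on the node set `N`: its graph, which nodes are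
terminal, which neighbours `x`, `y`, `z` of a node `b` of degree three are in counter-clockwise
order around it (`ccw b x y z`), and which edges are directed `x → y` (`arrow x y`). -/
structure DirectedPlaneGraph (N : Type) where
  graph : SimpleGraph N
  terminal : Set N
  ccw : N → N → N → N → Prop
  arrow : N → N → Prop

/-- An isomorphism of partially directed plane trees. -/
structure DirectedPlaneGraph.Iso {N N' : Type} (D : DirectedPlaneGraph N)
    (D' : DirectedPlaneGraph N') where
  toEquiv : N ≃ N'
  adj_iff : ∀ x y, D'.graph.Adj (toEquiv x) (toEquiv y) ↔ D.graph.Adj x y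
  terminal_iff : ∀ x, toEquiv x ∈ D'.terminal ↔ x ∈ D.terminal
  ccw_iff : ∀ b x y z,
    D'.ccw (toEquiv b) (toEquiv x) (toEquiv y) (toEquiv z) ↔ D.ccw b x y z
  arrow_iff : ∀ x y, D'.arrow (toEquiv x) (toEquiv y) ↔ D.arrow x y

/-- A visibility path: a sequence of at least two nodes, starting with a triangle (non-terminal)
node followed by one of its neighbours, such that from the second node on a terminal node is the
last one, and a triangle node `b`, reached from `a` and with neighbours `a, r, l` in
counter-clockwise order, is followed by `r` if the edge `ab` is directed `a ← b` and by `l` if it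
is directed `a → b`. -/
structure DirectedPlaneGraph.IsVisibilityPath {N : Type} (D : DirectedPlaneGraph N)
    (x : List N) : Prop where
  two_le : 2 ≤ x.length
  start : x[0] ∉ D.terminal
  start_adj : D.graph.Adj x[0] x[1]
  terminal_last : ∀ (i : ℕ) (hi : i + 1 < x.length), x[i + 1] ∈ D.terminal → i + 2 = x.length
  step : ∀ (i : ℕ) (hi : i + 1 < x.length), x[i + 1] ∉ D.terminal →
    ∃ (hi' : i + 2 < x.length) (r l : N), D.ccw x[i + 1] x[i] r l ∧
      ((D.arrow x[i + 1] x[i] ∧ x[i + 2] = r) ∨ (D.arrow x[i] x[i + 1] ∧ x[i + 2] = l))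

/-! ### The directed dual of a triangulation -/

/-- The nodes of the dual tree: a triangle node `Sum.inl t` for each triangle `t` and a terminal
node `Sum.inr i` for each polygon edge `i`. -/
abbrev Node {n : ℕ} (T : Finset (Finset (Fin n))) : Type := {t // t ∈ T} ⊕ Fin n

/-- The edges of the triangulation that belong to a node: the three edges of the triangle for a
triangle node, the polygon edge itself for a terminal node. -/
def nodeEdges {n : ℕ} {T : Finset (Finset (Fin n))} : Node T → Set (Sym2 (Fin n))
  | Sum.inl t => {e | ¬ e.IsDiag ∧ ∀ v ∈ e, v ∈ t.1}
  | Sum.inr i => {s(i, finRotate n i)}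

/-- The ordered pair `(a, b)` of triangles is right-reflex: they share an edge `vw`, with `u` the
third corner of `a` and `x` that of `b`. The quadrilateral union of `a` and `b` has the
counter-clockwise boundary `u, v, x, w`, the vertex `v` is on the right-hand side when one goes
straight from `a` to `b`, and the boundary makes a right turn at `v`, i.e. `v` is reflex. -/
def RightReflex {n : ℕ} (P : Polygon Plane n) (a b : Finset (Fin n)) : Prop :=
  ∃ u v w x : Fin n, a = {u, v, w} ∧ b = {v, x, w} ∧
    0 < orient (P u) (P v) (P w) ∧ 0 < orient (P v) (P x) (P w) ∧ orient (P u) (P v) (P x) < 0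

/-- The directed dual of a triangulation `T` of `P`. Two nodes are adjacent if they share an edge;
the neighbours of a triangle are in counter-clockwise order if the edges of the triangle that they
lie across are; `a → b` if `(a, b)` is right-reflex. -/
def directedDual {n : ℕ} (P : Polygon Plane n) (T : Finset (Finset (Fin n))) :
    DirectedPlaneGraph (Node T) where
  graph :=
    { Adj := fun x y => x ≠ y ∧ (nodeEdges x ∩ nodeEdges y).Nonempty
      symm := ⟨fun x y h => ⟨h.1.symm, by rw [Set.inter_comm]; exact h.2⟩⟩
      loopless := ⟨fun _ h => h.1 rfl⟩ }
  terminal := Set.range Sum.inr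
  ccw b x y z := ∃ (t : {t // t ∈ T}) (p q r : Fin n), b = Sum.inl t ∧ t.1 = {p, q, r} ∧
    0 < orient (P p) (P q) (P r) ∧ x ≠ b ∧ y ≠ b ∧ z ≠ b ∧
    s(p, q) ∈ nodeEdges x ∧ s(q, r) ∈ nodeEdges y ∧ s(r, p) ∈ nodeEdges z
  arrow x y := ∃ a b : {t // t ∈ T}, x = Sum.inl a ∧ y = Sum.inl b ∧ RightReflex P a.1 b.1

end PolyVis

namespace PolyVis

/-! ### Plane geometry -/

/-! Two adjacent triangles of a deflated polygon never form a convex quadrilateral, since its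
diagonals would be crossing visible segments; so an endpoint of the common edge is reflex
(`Tri.reflex`). This reflex vertex tells where sight lines go. Let a ray from `u` pass from the
triangle `z p q` through the edge `p q`, with `p` on its right, into `p y q`, and let `f` be the
linear function `orient u c`, which vanishes on the ray. If `y` is on the right, `q` is maximal for
`f` among `z, y, q`, hence not reflex. So `p` is reflex, `y` is even farther to the right, and the
ray leaves through `y q`: the turn that the direction of the dual edge prescribes. The left-hand
case is symmetric (`Sight.next`).

No vertex on the ray behind the first crossed edge is visible from `u`, because the segment to it
would cross that edge (`Clear`). Hence a visibility path follows a ray from `u` and ends at an edge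
seen from `u` (`seesEdge_of_leads`). Conversely, along a sight line the crossed edges get wider as
measured by `f`, so the walk ends, and it ends at the right edge because sight lines do not cross
polygon edges (`Sight.good`). A sight line may instead run along a triangulation edge `u v` and
touch `v`; the path then turns around `v` to the triangle that the line enters there
(`exists_leads_of_touch`). This uses that the triangles at a vertex form one fan
(`IsTriangulation.exists_fan`).

The topological input is that every boundary point is a limit of outside points
(`IsDeflated.boundary_subset_closure_compl`). The boundary locally has two connected sides, so being
touched by the outside is an open and closed condition on the connected boundary. Consequently a
polygon edge has a triangle on one side only.

For the second claim, terminal nodes give the bijection of edges. A vertex is a fan of triangle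
corners, and a corner lies between consecutive neighbours of a triangle node; an isomorphism
respects both, so it carries fans to fans (`exists_corner_map`). -/

lemma orient_rotate (p q r : Plane) : orient q r p = orient p q r := by
  simp only [orient]; ring

lemma orient_swap (p q r : Plane) : orient q p r = -orient p q r := by
  simp only [orient]; ring

lemma orient_swap_right (p q r : Plane) : orient p r q = -orient p q r := by
  simp only [orient]; ring

lemma orient_self_left (p q : Plane) : orient p q p = 0 := by
  simp only [orient]; ring

lemma orient_self_right (p q : Plane) : orient p q q = 0 := by
  simp only [orient]; ring

lemma orient_combo (p q x y : Plane) {a b : ℝ} (h : a + b = 1) :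
    orient p q (a • x + b • y) = a * orient p q x + b * orient p q y := by
  obtain rfl : a = 1 - b := by linarith
  simp only [orient, PiLp.add_apply, PiLp.smul_apply, smul_eq_mul]; ring

lemma orient_ray (p q u c : Plane) (s : ℝ) :
    orient p q (u + s • (c - u)) = orient p q u + s * (orient p q c - orient p q u) := by
  simp only [orient, PiLp.add_apply, PiLp.smul_apply, PiLp.sub_apply, smul_eq_mul]; ring

lemma orient_ray_self (u c : Plane) (s : ℝ) : orient u c (u + s • (c - u)) = 0 := by
  rw [orient_ray, orient_self_left, orient_self_right]; ring

lemma orient_sum (a b c x : Plane) :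
    orient b c x + orient c a x + orient a b x = orient a b c := by
  simp only [orient]; ring

lemma orient_bary (a b c x : Plane) :
    orient a b c • x = orient b c x • a + orient c a x • b + orient a b x • c := by
  ext i
  fin_cases i <;> simp [orient] <;> ring

lemma plane_ext {x y : Plane} (h0 : x 0 = y 0) (h1 : x 1 = y 1) : x = y := by
  ext i; fin_cases i
  · exact h0
  · exact h1

lemma exists_ray {u c x : Plane} (huc : u ≠ c) (h : orient u c x = 0) :
    ∃ s : ℝ, x = u + s • (c - u) := by
  simp only [orient] at h
  by_cases h0 : c 0 - u 0 = 0
  · have h1 : c 1 - u 1 ≠ 0 := fun h1 => huc (plane_ext (by linarith) (by linarith))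
    refine ⟨(x 1 - u 1) / (c 1 - u 1), plane_ext ?_ ?_⟩
    · simp only [PiLp.add_apply, PiLp.smul_apply, PiLp.sub_apply, smul_eq_mul, h0]
      have : (c 1 - u 1) * (x 0 - u 0) = 0 := by rw [h0] at h; linarith
      rcases mul_eq_zero.1 this with h2 | h2
      · exact absurd h2 h1
      · linarith
    · simp only [PiLp.add_apply, PiLp.smul_apply, PiLp.sub_apply, smul_eq_mul]
      field_simp; ring
  · refine ⟨(x 0 - u 0) / (c 0 - u 0), plane_ext ?_ ?_⟩
    · simp only [PiLp.add_apply, PiLp.smul_apply, PiLp.sub_apply, smul_eq_mul]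
      field_simp; ring
    · simp only [PiLp.add_apply, PiLp.smul_apply, PiLp.sub_apply, smul_eq_mul]
      field_simp; linarith

lemma ray_mem_segment (u c : Plane) {s s' : ℝ} (h0 : 0 ≤ s) (h : s ≤ s') :
    u + s • (c - u) ∈ segment ℝ u (u + s' • (c - u)) := by
  rw [segment_eq_image']
  rcases eq_or_lt_of_le (h0.trans h) with h1 | h1
  · exact ⟨0, by simp, by
      obtain rfl : s = 0 := le_antisymm (h1 ▸ h) h0
      simp⟩
  · refine ⟨s / s', ⟨by positivity, (div_le_one h1).2 h⟩, ?_⟩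
    simp only [add_sub_cancel_left, smul_smul, div_mul_cancel₀ _ h1.ne']

lemma ray_mem_openSegment (u c : Plane) {s s' : ℝ} (h0 : 0 < s) (h : s < s') :
    u + s • (c - u) ∈ openSegment ℝ u (u + s' • (c - u)) := by
  rw [openSegment_eq_image']
  have h1 := h0.trans h
  refine ⟨s / s', ⟨by positivity, (div_lt_one h1).2 h⟩, ?_⟩
  simp only [add_sub_cancel_left, smul_smul, div_mul_cancel₀ _ h1.ne']

/-- A linear function on the plane satisfies the three-term relation at `p`. -/
lemma orient_plucker (u c p q y z : Plane) :
    orient p y z * (orient u c q - orient u c p) =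
      orient p y q * (orient u c z - orient u c p) +
      orient p q z * (orient u c y - orient u c p) := by
  simp only [orient]; ring

/-- The linear function `orient u c` is minimal at `p` among `z, p, y`, so the edges from `p` point
into one half-plane and `p` is not reflex. A negative value would make one side of `orient_plucker`
negative and leave the other nonnegative. `orient_nonneg_of_left` is the same at a maximum `q`. -/
lemma orient_nonneg_of_right {u c p q y z : Plane} (hz : orient u c p ≤ orient u c z)
    (hq : orient u c p < orient u c q) (hy : orient u c p ≤ orient u c y)
    (h1 : 0 < orient p y q) (h2 : 0 < orient p q z) : 0 ≤ orient z p y := by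
  have h := orient_plucker u c p q y z
  rw [← orient_rotate z p y]
  by_contra! hn
  have := mul_neg_of_neg_of_pos hn (sub_pos.2 hq)
  have := mul_nonneg h1.le (sub_nonneg.2 hz)
  have := mul_nonneg h2.le (sub_nonneg.2 hy)
  linarith

lemma orient_nonneg_of_left {u c p q y z : Plane} (hz : orient u c z ≤ orient u c q)
    (hq : orient u c p < orient u c q) (hy : orient u c y ≤ orient u c q)
    (h1 : 0 < orient p y q) (h2 : 0 < orient p q z) : 0 ≤ orient y q z := by
  have h : orient y q z * (orient u c q - orient u c p) =
      orient p y q * (orient u c q - orient u c z) +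
      orient p q z * (orient u c q - orient u c y) := by
    simp only [orient]; ring
  by_contra! hn
  have := mul_neg_of_neg_of_pos hn (sub_pos.2 hq)
  have := mul_nonneg h1.le (sub_nonneg.2 hz)
  have := mul_nonneg h2.le (sub_nonneg.2 hy)
  linarith

/-- The point where the segment `x y` meets the line `a b`. -/
lemma exists_mem_segment_orient_eq_zero (a b : Plane) {x y : Plane} (hx : orient a b x ≤ 0)
    (hy : 0 ≤ orient a b y) (h : orient a b x < orient a b y) :
    ∃ m ∈ segment ℝ x y, orient a b m = 0 := by
  have hd : 0 < orient a b y - orient a b x := sub_pos.2 h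
  have h1 : orient a b y / (orient a b y - orient a b x) +
      -orient a b x / (orient a b y - orient a b x) = 1 := by field_simp; ring
  refine ⟨(orient a b y / (orient a b y - orient a b x)) • x +
    (-orient a b x / (orient a b y - orient a b x)) • y,
    ⟨_, _, by positivity, div_nonneg (by linarith) hd.le, h1, rfl⟩, ?_⟩
  rw [orient_combo _ _ _ _ h1]; field_simp; ring

lemma mem_openSegment_of_orient {a b x y m : Plane} (hx : orient a b x < 0)
    (hy : 0 < orient a b y) (hm : m ∈ segment ℝ x y) (h0 : orient a b m = 0) :
    m ∈ openSegment ℝ x y := by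
  refine mem_openSegment_of_ne_left_right ?_ ?_ hm
  · rintro rfl; exact hx.ne h0
  · rintro rfl; exact hy.ne' h0

lemma exists_mem_openSegment_orient_eq_zero (a b : Plane) {x y : Plane} (hx : orient a b x < 0)
    (hy : 0 < orient a b y) : ∃ m ∈ openSegment ℝ x y, orient a b m = 0 := by
  obtain ⟨m, hm, h0⟩ := exists_mem_segment_orient_eq_zero a b hx.le hy.le (hx.trans hy)
  exact ⟨m, mem_openSegment_of_orient hx hy hm h0, h0⟩

/-! ### Half-planes and triangles. -/

lemma convex_orient_nonneg (a b : Plane) : Convex ℝ {x | 0 ≤ orient a b x} := by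
  intro x hx y hy s t hs ht h
  simp only [Set.mem_ofPred_eq] at *
  rw [orient_combo _ _ _ _ h]; positivity

lemma convex_orient_pos (a b : Plane) : Convex ℝ {x | 0 < orient a b x} := by
  intro x hx y hy s t hs ht h
  simp only [Set.mem_ofPred_eq] at *
  rw [orient_combo _ _ _ _ h]
  rcases hs.eq_or_lt with rfl | hs'
  · obtain rfl : t = 1 := by linarith
    simpa using hy
  · have := mul_pos hs' hx
    have := mul_nonneg ht hy.le
    linarith

lemma convex_orient_neg (a b : Plane) : Convex ℝ {x | orient a b x < 0} := by
  convert convex_orient_pos b a using 3 with x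
  rw [orient_swap]; simp

lemma continuous_orient (a b : Plane) : Continuous (orient a b) := by
  unfold orient; fun_prop

/-- By `orient_bary` and `orient_sum`, the three values are the barycentric coordinates of `x`,
scaled by `orient a b c`. -/
lemma mem_convexHull_triangle {a b c : Plane} (h : 0 < orient a b c) (x : Plane) :
    x ∈ convexHull ℝ {a, b, c} ↔
      0 ≤ orient a b x ∧ 0 ≤ orient b c x ∧ 0 ≤ orient c a x := by
  constructor
  · intro hx
    refine ⟨?_, ?_, ?_⟩
    · refine convexHull_min ?_ (convex_orient_nonneg a b) hx
      rintro y (rfl | rfl | rfl) <;>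
        simp [orient_self_left, orient_self_right, h.le]
    · refine convexHull_min ?_ (convex_orient_nonneg b c) hx
      rintro y (rfl | rfl | rfl) <;>
        simp [orient_self_left, orient_self_right]
      rw [orient_rotate]; exact h.le
    · refine convexHull_min ?_ (convex_orient_nonneg c a) hx
      rintro y (rfl | rfl | rfl) <;>
        simp [orient_self_left, orient_self_right]
      rw [← orient_rotate]; exact h.le
  · rintro ⟨h1, h2, h3⟩
    have hb := orient_bary a b c x
    have hs := orient_sum a b c x
    have hx : x = (orient b c x / orient a b c) • a + (orient c a x / orient a b c) • b +
        (orient a b x / orient a b c) • c := by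
      rw [div_eq_inv_mul, div_eq_inv_mul, div_eq_inv_mul, mul_smul, mul_smul, mul_smul,
        ← smul_add, ← smul_add, ← hb, smul_smul, inv_mul_cancel₀ h.ne', one_smul]
    rw [hx]
    have ha : a ∈ convexHull ℝ {a, b, c} := subset_convexHull _ _ (by simp)
    have hb' : b ∈ convexHull ℝ {a, b, c} := subset_convexHull _ _ (by simp)
    have hc : c ∈ convexHull ℝ {a, b, c} := subset_convexHull _ _ (by simp)
    have := (convex_convexHull ℝ ({a, b, c} : Set Plane)).sum_mem (t := Finset.univ)
      (w := ![orient b c x / orient a b c, orient c a x / orient a b c, orient a b x / orient a b c])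
      (z := ![a, b, c]) ?_ ?_ ?_
    · simpa [Fin.sum_univ_three] using this
    · intro i _; fin_cases i <;> simp <;> positivity
    · simp [Fin.sum_univ_three]; rw [← add_div, ← add_div, hs, div_self h.ne']
    · intro i _; fin_cases i <;> simp [ha, hb', hc]

/-- A point of the triangle `a b c` that lies on the line `a b` lies on the edge. -/
lemma mem_segment_of_orient_eq_zero {a b c x : Plane} (h : 0 < orient a b c)
    (h1 : orient a b x = 0) (h2 : 0 ≤ orient b c x) (h3 : 0 ≤ orient c a x) :
    x ∈ segment ℝ a b := by
  have hb := orient_bary a b c x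
  have hs := orient_sum a b c x
  rw [h1, zero_smul, add_zero] at hb
  rw [h1, add_zero] at hs
  refine ⟨orient b c x / orient a b c, orient c a x / orient a b c, by positivity, by positivity,
    by rw [← add_div, hs, div_self h.ne'], ?_⟩
  rw [div_eq_inv_mul, div_eq_inv_mul, mul_smul, mul_smul, ← smul_add, ← hb, smul_smul,
    inv_mul_cancel₀ h.ne', one_smul]

/-- The open triangle `a b c`. -/
def openTriangle (a b c : Plane) : Set Plane :=
  {x | 0 < orient a b x ∧ 0 < orient b c x ∧ 0 < orient c a x}

lemma isOpen_openTriangle (a b c : Plane) : IsOpen (openTriangle a b c) :=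
  (isOpen_lt continuous_const (continuous_orient a b)).inter
    ((isOpen_lt continuous_const (continuous_orient b c)).inter
      (isOpen_lt continuous_const (continuous_orient c a)))

lemma openTriangle_subset_interior {a b c : Plane} (h : 0 < orient a b c) :
    openTriangle a b c ⊆ interior (convexHull ℝ {a, b, c}) :=
  interior_maximal (fun x hx => (mem_convexHull_triangle h x).2
    ⟨hx.1.le, hx.2.1.le, hx.2.2.le⟩) (isOpen_openTriangle a b c)

/-- A point of the closed triangle is in the open triangle or on an edge. -/
lemma mem_openTriangle_or_segment {a b c x : Plane} (h : 0 < orient a b c)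
    (hx : x ∈ convexHull ℝ {a, b, c}) :
    x ∈ openTriangle a b c ∨ x ∈ segment ℝ a b ∨ x ∈ segment ℝ b c ∨ x ∈ segment ℝ c a := by
  obtain ⟨h1, h2, h3⟩ := (mem_convexHull_triangle h x).1 hx
  rcases h1.eq_or_lt with h1' | h1'
  · exact Or.inr (Or.inl (mem_segment_of_orient_eq_zero h h1'.symm h2 h3))
  rcases h2.eq_or_lt with h2' | h2'
  · exact Or.inr (Or.inr (Or.inl (mem_segment_of_orient_eq_zero
      (by rw [orient_rotate]; exact h) h2'.symm h3 h1)))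
  rcases h3.eq_or_lt with h3' | h3'
  · exact Or.inr (Or.inr (Or.inr (mem_segment_of_orient_eq_zero
      (by rw [← orient_rotate]; exact h) h3'.symm h1 h2)))
  exact Or.inl ⟨h1', h2', h3'⟩

/-- A convex combination with positive weights of a point of the open triangle and a point of the
closed one is in the open one. -/
lemma openSegment_subset_openTriangle {a b c x y : Plane} (h : 0 < orient a b c)
    (hx : x ∈ convexHull ℝ {a, b, c}) (hy : y ∈ openTriangle a b c) :
    openSegment ℝ x y ⊆ openTriangle a b c := by
  rintro _ ⟨s, t, hs, ht, hst, rfl⟩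
  obtain ⟨h1, h2, h3⟩ := (mem_convexHull_triangle h x).1 hx
  obtain ⟨g1, g2, g3⟩ := hy
  refine ⟨?_, ?_, ?_⟩ <;> rw [orient_combo _ _ _ _ hst]
  · have := mul_nonneg hs.le h1; have := mul_pos ht g1; linarith
  · have := mul_nonneg hs.le h2; have := mul_pos ht g2; linarith
  · have := mul_nonneg hs.le h3; have := mul_pos ht g3; linarith

/-- Two nondegenerate triangles on the same side of a common edge overlap. -/
lemma openTriangle_inter_nonempty {a b c d : Plane} (hc : 0 < orient a b c)
    (hd : 0 < orient a b d) : (openTriangle a b c ∩ openTriangle a b d).Nonempty := by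
  -- `t` measures how far the midpoint of `a b` moves towards `c`. Up to a positive factor and a
  -- positive summand, the two inequalities say that the moved point stays on the inner side of `b
  -- d` and `d a`.
  obtain ⟨t, ht0, ht1, ht2⟩ : ∃ t : ℝ, 0 < t ∧
      0 < orient b d a + t * (orient b d c - orient b d a + (orient b d c - orient b d b)) ∧
      0 < orient d a b + t * (orient d a c - orient d a b + (orient d a c - orient d a a)) := by
    have hA : 0 < orient b d a := by rw [orient_rotate]; exact hd
    have hB : 0 < orient d a b := by rw [← orient_rotate]; exact hd
    set A := orient b d c - orient b d a + (orient b d c - orient b d b)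
    set B := orient d a c - orient d a b + (orient d a c - orient d a a)
    refine ⟨min (orient b d a / (1 + |A|)) (orient d a b / (1 + |B|)), by positivity, ?_, ?_⟩
    · have h1 : min (orient b d a / (1 + |A|)) (orient d a b / (1 + |B|)) ≤
        orient b d a / (1 + |A|) := min_le_left _ _
      have h0 : 0 < min (orient b d a / (1 + |A|)) (orient d a b / (1 + |B|)) := by positivity
      rw [le_div_iff₀ (by positivity)] at h1
      have := neg_abs_le A
      nlinarith
    · have h1 : min (orient b d a / (1 + |A|)) (orient d a b / (1 + |B|)) ≤
        orient d a b / (1 + |B|) := min_le_right _ _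
      have h0 : 0 < min (orient b d a / (1 + |A|)) (orient d a b / (1 + |B|)) := by positivity
      rw [le_div_iff₀ (by positivity)] at h1
      have := neg_abs_le B
      nlinarith
  -- the point `(a + b) / 2` moved a little towards `c`
  have ht3 : 0 < 1 + 2 * t := by linarith
  refine ⟨(1 / (2 + 2 * t)) • (a + b + (2 * t) • c), ?_, ?_⟩
  all_goals
    have hk : 0 < 1 / (2 + 2 * t) := by positivity
  · have e1 : orient a b ((1 / (2 + 2 * t)) • (a + b + (2 * t) • c)) =
        1 / (2 + 2 * t) * (2 * t * orient a b c) := by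
      simp only [orient, PiLp.add_apply, PiLp.smul_apply, smul_eq_mul]; field_simp; ring
    have e2 : orient b c ((1 / (2 + 2 * t)) • (a + b + (2 * t) • c)) =
        1 / (2 + 2 * t) * orient a b c := by
      simp only [orient, PiLp.add_apply, PiLp.smul_apply, smul_eq_mul]; field_simp; ring
    have e3 : orient c a ((1 / (2 + 2 * t)) • (a + b + (2 * t) • c)) =
        1 / (2 + 2 * t) * orient a b c := by
      simp only [orient, PiLp.add_apply, PiLp.smul_apply, smul_eq_mul]; field_simp; ring
    exact ⟨by rw [e1]; positivity, by rw [e2]; positivity, by rw [e3]; positivity⟩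
  · have e1 : orient a b ((1 / (2 + 2 * t)) • (a + b + (2 * t) • c)) =
        1 / (2 + 2 * t) * (2 * t * orient a b c) := by
      simp only [orient, PiLp.add_apply, PiLp.smul_apply, smul_eq_mul]; field_simp; ring
    have e2 : orient b d ((1 / (2 + 2 * t)) • (a + b + (2 * t) • c)) =
        1 / (2 + 2 * t) * (orient b d a +
          t * (orient b d c - orient b d a + (orient b d c - orient b d b)) + t * orient b d a) := by
      simp only [orient, PiLp.add_apply, PiLp.smul_apply, smul_eq_mul]; field_simp; ring
    have e3 : orient d a ((1 / (2 + 2 * t)) • (a + b + (2 * t) • c)) =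
        1 / (2 + 2 * t) * (orient d a b +
          t * (orient d a c - orient d a b + (orient d a c - orient d a a)) + t * orient d a b) := by
      simp only [orient, PiLp.add_apply, PiLp.smul_apply, smul_eq_mul]; field_simp; ring
    have hA : 0 < orient b d a := by rw [orient_rotate]; exact hd
    have hB : 0 < orient d a b := by rw [← orient_rotate]; exact hd
    exact ⟨by rw [e1]; positivity, by rw [e2]; exact mul_pos hk (by nlinarith),
      by rw [e3]; exact mul_pos hk (by nlinarith)⟩

/-! ### The boundary of a polygon -/

lemma edgeSet_eq {n : ℕ} (P : Polygon Plane n) (i : Fin n) :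
    P.edgeSet ℝ i = segment ℝ (P i) (P (finRotate n i)) :=
  affineSegment_eq_segment ℝ _ _

lemma isCompact_edgeSet {n : ℕ} (P : Polygon Plane n) (i : Fin n) :
    IsCompact (P.edgeSet ℝ i) := by
  rw [edgeSet_eq, segment_eq_image]
  exact isCompact_Icc.image (by fun_prop)

lemma isClosed_boundary {n : ℕ} (P : Polygon Plane n) : IsClosed (P.boundary ℝ) :=
  isClosed_iUnion_of_finite fun i => (isCompact_edgeSet P i).isClosed

lemma edgeSet_subset_boundary {n : ℕ} (P : Polygon Plane n) (i : Fin n) :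
    P.edgeSet ℝ i ⊆ P.boundary ℝ := Set.subset_iUnion (fun i => P.edgeSet ℝ i) i

lemma vertex_mem_edgeSet {n : ℕ} (P : Polygon Plane n) (i : Fin n) : P i ∈ P.edgeSet ℝ i := by
  rw [edgeSet_eq]; exact left_mem_segment _ _ _

lemma succ_mem_edgeSet {n : ℕ} (P : Polygon Plane n) (i : Fin n) :
    P (finRotate n i) ∈ P.edgeSet ℝ i := by
  rw [edgeSet_eq]; exact right_mem_segment _ _ _

lemma vertex_mem_boundary {n : ℕ} (P : Polygon Plane n) (i : Fin n) : P i ∈ P.boundary ℝ :=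
  edgeSet_subset_boundary P i (vertex_mem_edgeSet P i)

lemma boundary_subset_closedRegion {n : ℕ} (P : Polygon Plane n) :
    P.boundary ℝ ⊆ closedRegion P := Set.subset_union_left

lemma isPreconnected_boundary {n : ℕ} (P : Polygon Plane n) : IsPreconnected (P.boundary ℝ) := by
  obtain _ | n := n
  · rw [Polygon.boundary, Set.iUnion_of_empty]; exact isPreconnected_empty
  refine IsPreconnected.iUnion_of_chain (s := fun i => P.edgeSet ℝ i) (fun i => ?_) (fun i => ?_)
  · rw [edgeSet_eq]; exact (convex_segment _ _).isPreconnected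
  · rcases eq_or_ne i (Fin.last n) with rfl | hi
    · refine ⟨P (Fin.last n), vertex_mem_edgeSet P _, ?_⟩
      -- The successor of the last index is the index itself, so this link of the chain is trivial.
      rw [Order.succ_eq_iff_isMax.2 (isTop_iff_isMax.1 fun a => Fin.le_last a)]
      exact vertex_mem_edgeSet P _
    · refine ⟨P (finRotate _ i), succ_mem_edgeSet P _, ?_⟩
      have : Order.succ i = finRotate _ i := by
        rw [finRotate_apply, Fin.orderSucc_eq]
        obtain ⟨j, rfl⟩ := Fin.exists_castSucc_eq.2 hi
        simp
      rw [this]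
      exact vertex_mem_edgeSet P _

lemma finRotate_ne {n : ℕ} (hn : 3 ≤ n) (i : Fin n) : finRotate n i ≠ i := by
  obtain ⟨k, rfl⟩ := Nat.exists_eq_add_of_le' hn
  rw [finRotate_apply]
  simp

lemma finRotate_finRotate_ne {n : ℕ} (hn : 3 ≤ n) (i : Fin n) :
    finRotate n (finRotate n i) ≠ i := by
  obtain ⟨k, rfl⟩ := Nat.exists_eq_add_of_le' hn
  rw [finRotate_apply, finRotate_apply, add_assoc]
  intro h
  have h2 := add_eq_left.1 h
  have := congrArg Fin.val h2
  simp only [Fin.val_add, Fin.val_one, Fin.val_zero] at this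
  rw [Nat.mod_eq_of_lt (by omega)] at this
  omega

variable {n : ℕ} {P : Polygon Plane n}

/-! ### Visible segments of a deflated polygon. -/

lemma IsSimple.adj_succ (hP : IsSimple P) (i : Fin n) :
    (visibilityGraph P).Adj i (finRotate n i) :=
  ⟨(finRotate_ne hP.three_le i).symm, by
    rw [← edgeSet_eq]
    exact (edgeSet_subset_boundary P i).trans (boundary_subset_closedRegion P)⟩

lemma midpoint_mem_openSegment_self (x y : Plane) :
    (1 / 2 : ℝ) • x + (1 / 2 : ℝ) • y ∈ openSegment ℝ x y :=
  ⟨1 / 2, 1 / 2, by norm_num, by norm_num, by norm_num, rfl⟩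

/-- A segment between vertices that see each other contains no other vertex. -/
lemma IsDeflated.not_mem_openSegment (hP : IsDeflated P) {v w : Fin n}
    (h : (visibilityGraph P).Adj v w) (k : Fin n) : P k ∉ openSegment ℝ (P v) (P w) := by
  intro hk
  have hvw : P v ≠ P w := fun e => h.1 (hP.simple.injective e)
  have hkv : v ≠ k := by
    rintro rfl; exact hvw (left_mem_openSegment_iff.1 hk)
  have hkw : k ≠ w := by
    rintro rfl; exact hvw (right_mem_openSegment_iff.1 hk)
  have hadj : (visibilityGraph P).Adj v k := ⟨hkv, ((convex_segment _ _).segment_subset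
    (left_mem_segment _ _ _) (openSegment_subset_segment _ _ _ hk)).trans h.2⟩
  have hne : s(v, k) ≠ s(v, w) := by
    intro e
    rcases Sym2.eq_iff.1 e with ⟨-, e⟩ | ⟨e, e'⟩
    · exact hkw e
    · exact hkv e'.symm
  -- Both open segments leave `P v` in the same direction, so the midpoint of the shorter one lies
  -- on both.
  refine Set.disjoint_left.1 (hP.no_crossing v k v w hadj h hne)
    (midpoint_mem_openSegment_self (P v) (P k)) ?_
  obtain ⟨a, b, ha, hb, hab, e⟩ := hk
  refine ⟨1 / 2 + a / 2, b / 2, by positivity, by positivity, by linarith, ?_⟩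
  rw [← e, smul_add, ← add_assoc, smul_smul, smul_smul, add_smul]
  congr 3 <;> ring

lemma segment_subset_union {x y m : Plane} (hm : m ∈ openSegment ℝ x y) :
    segment ℝ x y ⊆ segment ℝ x m ∪ segment ℝ m y := by
  intro z hz
  obtain ⟨a, b, ha, hb, hab, e⟩ := hm
  obtain ⟨a', b', ha', hb', hab', e'⟩ := hz
  rcases le_total b' b with hle | hle
  · refine Or.inl ⟨1 - b' / b, b' / b, ?_, by positivity, by ring, ?_⟩
    · rw [sub_nonneg, div_le_one hb]; exact hle
    · rw [← e, ← e', smul_add, smul_smul, smul_smul, ← add_assoc, ← add_smul]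
      congr 2 <;> field_simp
      linear_combination b' * hab - b * hab'
  · refine Or.inr ⟨a' / a, 1 - a' / a, by positivity, ?_, by ring, ?_⟩
    · rw [sub_nonneg, div_le_one ha]; linarith
    · rw [← e, ← e', smul_add, smul_smul, smul_smul, add_assoc, ← add_smul]
      congr 2 <;> field_simp; rw [eq_sub_of_add_eq' hab', ← hab]
      linear_combination (a' - a) * hab

/-- Three consecutive corners of a deflated polygon are not collinear. -/
lemma IsDeflated.orient_consecutive_ne_zero (hP : IsDeflated P) (k : Fin n) :
    orient (P (finRotate n k)) (P (finRotate n (finRotate n k))) (P k) ≠ 0 := by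
  intro h
  set l := finRotate n k
  have h3 := hP.simple.three_le
  have hl : l ≠ finRotate n l := (finRotate_ne h3 l).symm
  obtain ⟨s, hs⟩ := exists_ray (fun e => hl (hP.simple.injective e)) h
  have hkl : (visibilityGraph P).Adj l k := (hP.simple.adj_succ k).symm
  have hll := hP.simple.adj_succ l
  -- On their line, `P l` has coordinate 0, its successor 1 and `P k` has `s`. Unless two vertices
  -- coincide, one of the three lies strictly between the other two, which see each other in every
  -- case.
  rcases lt_trichotomy s 0 with h0 | rfl | h0
  · -- `l` lies between its neighbours
    have hmem : P l ∈ openSegment ℝ (P k) (P (finRotate n l)) := by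
      refine ⟨1 / (1 - s), -s / (1 - s), div_pos one_pos (by linarith),
        div_pos (by linarith) (by linarith), ?_, ?_⟩
      · field_simp; rw [div_eq_one_iff_eq (by linarith)]; ring
      · rw [hs]
        have : (1 - s) ≠ 0 := by linarith
        apply plane_ext <;> simp only [PiLp.add_apply, PiLp.smul_apply, PiLp.sub_apply,
          smul_eq_mul] <;> field_simp <;> ring
    refine hP.not_mem_openSegment (v := k) (w := finRotate n l)
      ⟨(finRotate_finRotate_ne h3 k).symm, ?_⟩ l hmem
    intro x hx
    rcases segment_subset_union hmem hx with h2 | h2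
    · exact hkl.symm.2 h2
    · exact hll.2 h2
  · rw [zero_smul, add_zero] at hs
    exact hkl.1 (hP.simple.injective hs.symm)
  · rcases lt_trichotomy s 1 with h1 | rfl | h1
    · refine hP.not_mem_openSegment hll k ?_
      have := ray_mem_openSegment (P l) (P (finRotate n l)) h0 h1
      rwa [← hs, one_smul, add_sub_cancel] at this
    · rw [one_smul, add_sub_cancel] at hs
      exact finRotate_finRotate_ne h3 k (hP.simple.injective hs.symm)
    · refine hP.not_mem_openSegment hkl (finRotate n l) ?_
      have := ray_mem_openSegment (P l) (P (finRotate n l)) one_pos h1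
      rwa [← hs, one_smul, add_sub_cancel] at this

/-! ### The outside of a polygon touches every boundary point -/

/-- A connected set off the boundary that meets the outside lies outside. -/
lemma subset_compl_closedRegion {C : Set Plane} (hC : IsPreconnected C)
    (hB : C ⊆ (P.boundary ℝ)ᶜ) (h : (C ∩ (closedRegion P)ᶜ).Nonempty) :
    C ⊆ (closedRegion P)ᶜ := by
  obtain ⟨x, hx, hxA⟩ := h
  rintro y hy (h | h)
  · exact hB hy h
  · refine hxA (Or.inr ⟨hB hx, ?_⟩)
    rw [connectedComponentIn_eq (hC.subset_connectedComponentIn hx hB hy)]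
    exact h.2

lemma isOpen_openRegion : IsOpen (openRegion P) := by
  rw [isOpen_iff_mem_nhds]
  intro x hx
  have ho : IsOpen (connectedComponentIn (P.boundary ℝ)ᶜ x) :=
    (isClosed_boundary P).isOpen_compl.connectedComponentIn
  filter_upwards [ho.mem_nhds (mem_connectedComponentIn hx.1)] with y hy
  refine ⟨connectedComponentIn_subset _ _ hy, ?_⟩
  rw [← connectedComponentIn_eq hy]
  exact hx.2

lemma closure_inter_of_ray {U K : Set Plane} (hU : IsOpen U) {y w : Plane} (hy : y ∈ U)
    (h : ∀ ε : ℝ, 0 < ε → y + ε • w ∈ K) : y ∈ closure (U ∩ K) := by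
  have ht : Filter.Tendsto (fun ε : ℝ => y + ε • w) (nhdsWithin 0 (Set.Ioi 0)) (nhds y) := by
    have : Continuous fun ε : ℝ => y + ε • w := by fun_prop
    simpa using (this.tendsto 0).mono_left nhdsWithin_le_nhds
  refine mem_closure_of_tendsto ht ?_
  filter_upwards [ht.eventually (hU.mem_nhds hy), self_mem_nhdsWithin] with ε h1 h2
  exact ⟨h1, h ε h2⟩

/-- If both local sides `H₁`, `H₂` of the boundary within `U` are connected and touch all boundary
points in `U`, then the outside touches all boundary points in `U` as soon as it meets `U`. -/
lemma subset_closure_compl_of_sides {U H₁ H₂ : Set Plane}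
    (h₁ : IsPreconnected H₁) (h₂ : IsPreconnected H₂)
    (hB₁ : H₁ ⊆ (P.boundary ℝ)ᶜ) (hB₂ : H₂ ⊆ (P.boundary ℝ)ᶜ)
    (hd : U ⊆ closure (H₁ ∪ H₂)) (hc₁ : P.boundary ℝ ∩ U ⊆ closure H₁)
    (hc₂ : P.boundary ℝ ∩ U ⊆ closure H₂) (hA : IsClosed (closedRegion P))
    (hne : (U ∩ (closedRegion P)ᶜ).Nonempty) :
    P.boundary ℝ ∩ U ⊆ closure (closedRegion P)ᶜ := by
  obtain ⟨x, hxU, hx⟩ := hne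
  -- The outside is open and the two sides are dense in `U`, so the outside meets one of them and
  -- then contains it entirely.
  obtain ⟨y, hy, hyH⟩ := mem_closure_iff.1 (hd hxU) _ hA.isOpen_compl hx
  rcases hyH with hyH | hyH
  · exact hc₁.trans (closure_mono (subset_compl_closedRegion h₁ hB₁ ⟨y, hyH, hy⟩))
  · exact hc₂.trans (closure_mono (subset_compl_closedRegion h₂ hB₂ ⟨y, hyH, hy⟩))

lemma exists_normal {a b : Plane} (hab : a ≠ b) : ∃ (w : Plane) (k : ℝ), 0 < k ∧
    ∀ (y : Plane) (ε : ℝ), orient a b (y + ε • w) = orient a b y + ε * k := by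
  refine ⟨WithLp.toLp 2 ![-(b 1 - a 1), b 0 - a 0], (b 0 - a 0) ^ 2 + (b 1 - a 1) ^ 2, ?_, ?_⟩
  · by_contra! h
    have h0 : b 0 - a 0 = 0 := by nlinarith [sq_nonneg (b 0 - a 0), sq_nonneg (b 1 - a 1)]
    have h1 : b 1 - a 1 = 0 := by nlinarith [sq_nonneg (b 0 - a 0), sq_nonneg (b 1 - a 1)]
    exact hab (plane_ext (by linarith) (by linarith))
  · intro y ε
    simp [orient]; ring

/-- The two local sides are the open parts of the ball on either side of the line `a b`. -/
lemma boundary_near_edge {a b x : Plane} {r : ℝ} (hab : a ≠ b)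
    (hB : P.boundary ℝ ∩ Metric.ball x r ⊆ segment ℝ a b) (hA : IsClosed (closedRegion P))
    (hne : (Metric.ball x r ∩ (closedRegion P)ᶜ).Nonempty) :
    P.boundary ℝ ∩ Metric.ball x r ⊆ closure (closedRegion P)ᶜ := by
  have hline : ∀ y ∈ P.boundary ℝ ∩ Metric.ball x r, orient a b y = 0 := by
    intro y hy
    obtain ⟨s, t, -, -, hst, rfl⟩ := hB hy
    rw [orient_combo _ _ _ _ hst, orient_self_left, orient_self_right]; ring
  obtain ⟨w, k, hpos, hw⟩ := exists_normal hab
  have hc₁ : ∀ y ∈ Metric.ball x r, orient a b y = 0 →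
      y ∈ closure (Metric.ball x r ∩ {y | 0 < orient a b y}) := fun y hy h0 =>
    closure_inter_of_ray (w := w) Metric.isOpen_ball hy fun ε hε => by
      simp only [Set.mem_ofPred_eq, hw, h0, zero_add]; positivity
  have hc₂ : ∀ y ∈ Metric.ball x r, orient a b y = 0 →
      y ∈ closure (Metric.ball x r ∩ {y | orient a b y < 0}) := fun y hy h0 =>
    closure_inter_of_ray (w := -w) Metric.isOpen_ball hy fun ε hε => by
      simp only [Set.mem_ofPred_eq, smul_neg, ← neg_smul, hw, h0, zero_add]
      have := mul_pos hε hpos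
      linarith
  refine subset_closure_compl_of_sides (H₁ := Metric.ball x r ∩ {y | 0 < orient a b y})
    (H₂ := Metric.ball x r ∩ {y | orient a b y < 0})
    ((convex_ball x r).inter (convex_orient_pos a b)).isPreconnected
    ((convex_ball x r).inter (convex_orient_neg a b)).isPreconnected
    (fun y hy hyB => hy.2.ne' (hline y ⟨hyB, hy.1⟩))
    (fun y hy hyB => hy.2.ne (hline y ⟨hyB, hy.1⟩)) ?_
    (fun y hy => hc₁ y hy.2 (hline y hy)) (fun y hy => hc₂ y hy.2 (hline y hy)) hA hne
  intro y hy
  rcases lt_trichotomy (orient a b y) 0 with h | h | h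
  · exact subset_closure (Or.inr ⟨hy, h⟩)
  · exact closure_mono Set.subset_union_left (hc₁ y hy h)
  · exact subset_closure (Or.inl ⟨hy, h⟩)

/-- The local sides are the open sector at `x`, which is convex, and the union of two half-discs
that overlap behind `x`. Nothing says which of them is inside, so after exchanging `a` and `b` if
necessary this serves convex and reflex corners alike. -/
lemma boundary_near_corner {a b x : Plane} {r : ℝ} (hr : 0 < r) (hab : 0 < orient x a b)
    (hB : P.boundary ℝ ∩ Metric.ball x r ⊆ segment ℝ x a ∪ segment ℝ b x)
    (hA : IsClosed (closedRegion P)) (hne : (Metric.ball x r ∩ (closedRegion P)ᶜ).Nonempty) :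
    P.boundary ℝ ∩ Metric.ball x r ⊆ closure (closedRegion P)ᶜ := by
  have hbxa : orient b x a = orient x a b := by simp only [orient]; ring
  have hline : ∀ y ∈ P.boundary ℝ ∩ Metric.ball x r,
      (orient x a y = 0 ∧ 0 ≤ orient b x y) ∨ (0 ≤ orient x a y ∧ orient b x y = 0) := by
    intro y hy
    rcases hB hy with ⟨s, t, hs, ht, hst, rfl⟩ | ⟨s, t, hs, ht, hst, rfl⟩ <;>
      simp only [orient_combo _ _ _ _ hst, orient_self_left, orient_self_right, hbxa]
    · refine Or.inl ⟨by ring, ?_⟩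
      have := mul_nonneg ht hab.le; linarith
    · refine Or.inr ⟨?_, by ring⟩
      have := mul_nonneg hs hab.le; linarith
  set w : Plane := (a - x) + (b - x)
  have hw₁ : ∀ (y : Plane) (ε : ℝ), orient x a (y + ε • w) = orient x a y + ε * orient x a b := by
    intro y ε
    simp only [orient, w, PiLp.add_apply, PiLp.smul_apply, PiLp.sub_apply, smul_eq_mul]; ring
  have hw₂ : ∀ (y : Plane) (ε : ℝ), orient b x (y + ε • w) = orient b x y + ε * orient x a b := by
    intro y ε
    simp only [orient, w, PiLp.add_apply, PiLp.smul_apply, PiLp.sub_apply, smul_eq_mul]; ring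
  have hc₁ : ∀ y ∈ Metric.ball x r, 0 ≤ orient x a y → 0 ≤ orient b x y →
      y ∈ closure (Metric.ball x r ∩ ({y | 0 < orient x a y} ∩ {y | 0 < orient b x y})) :=
    fun y hy h1 h2 => closure_inter_of_ray (w := w) Metric.isOpen_ball hy fun ε hε => by
      have := mul_pos hε hab
      refine ⟨?_, ?_⟩ <;> simp only [Set.mem_ofPred_eq, hw₁, hw₂] <;> linarith
  have hc₂ : ∀ y ∈ Metric.ball x r, (orient x a y = 0 ∨ orient b x y = 0) →
      y ∈ closure (Metric.ball x r ∩ ({y | orient x a y < 0} ∪ {y | orient b x y < 0})) :=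
    fun y hy h => closure_inter_of_ray (w := -w) Metric.isOpen_ball hy fun ε hε => by
      have := mul_pos hε hab
      refine h.imp (fun h => ?_) (fun h => ?_) <;>
        simp only [Set.mem_ofPred_eq, smul_neg, ← neg_smul, hw₁, hw₂, h] <;> linarith
  refine subset_closure_compl_of_sides
    (H₁ := Metric.ball x r ∩ ({y | 0 < orient x a y} ∩ {y | 0 < orient b x y}))
    (H₂ := Metric.ball x r ∩ ({y | orient x a y < 0} ∪ {y | orient b x y < 0}))
    ((convex_ball x r).inter ((convex_orient_pos x a).inter (convex_orient_pos b x))).isPreconnected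
    ?_ ?_ ?_ ?_ (fun y hy => ?_) (fun y hy => ?_) hA hne
  · rw [Set.inter_union_distrib_left]
    have hx : x ∈ closure (Metric.ball x r ∩ ({y | orient x a y < 0} ∩ {y | orient b x y < 0})) :=
      closure_inter_of_ray (w := -w) Metric.isOpen_ball (Metric.mem_ball_self hr) fun ε hε => by
        have := mul_pos hε hab
        refine ⟨?_, ?_⟩ <;> simp only [Set.mem_ofPred_eq, smul_neg, ← neg_smul, hw₁, hw₂,
          orient_self_left, orient_self_right] <;> linarith
    obtain ⟨z, hz⟩ := closure_nonempty_iff.1 ⟨x, hx⟩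
    exact IsPreconnected.union z ⟨hz.1, hz.2.1⟩ ⟨hz.1, hz.2.2⟩
      ((convex_ball x r).inter (convex_orient_neg x a)).isPreconnected
      ((convex_ball x r).inter (convex_orient_neg b x)).isPreconnected
  · rintro y ⟨hy, h1, h2⟩ hyB
    simp only [Set.mem_ofPred_eq] at h1 h2
    rcases hline y ⟨hyB, hy⟩ with h | h <;> linarith
  · rintro y ⟨hy, h1⟩ hyB
    simp only [Set.mem_union, Set.mem_ofPred_eq] at h1
    rcases hline y ⟨hyB, hy⟩ with h | h <;> rcases h1 with h1 | h1 <;> linarith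
  · intro y hy
    by_cases h : orient x a y < 0 ∨ orient b x y < 0
    · exact subset_closure (Or.inr ⟨hy, h⟩)
    · push Not at h
      exact closure_mono Set.subset_union_left (hc₁ y hy h.1 h.2)
  · rcases hline y hy with h | h
    · exact hc₁ y hy.2 h.1.ge h.2
    · exact hc₁ y hy.2 h.1 h.2.ge
  · exact hc₂ y hy.2 ((hline y hy).imp And.left And.right)

/-- The edges are finitely many closed sets, so a small ball avoids all those that miss `x`. -/
lemma exists_ball_edges (P : Polygon Plane n) (x : Plane) :
    ∃ r > 0, ∀ y ∈ Metric.ball x r, ∀ i, y ∈ P.edgeSet ℝ i → x ∈ P.edgeSet ℝ i := by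
  have : ∀ᶠ y in nhds x, ∀ i, y ∈ P.edgeSet ℝ i → x ∈ P.edgeSet ℝ i := by
    rw [Filter.eventually_all]
    intro i
    by_cases hx : x ∈ P.edgeSet ℝ i
    · exact Filter.Eventually.of_forall fun _ _ => hx
    · filter_upwards [(isCompact_edgeSet P i).isClosed.isOpen_compl.mem_nhds hx] with y hy h
      exact absurd h hy
  obtain ⟨r, hr, h⟩ := Metric.eventually_nhds_iff_ball.1 this
  exact ⟨r, hr, h⟩

/-- Near a boundary point touched by the outside, all boundary points are. -/
lemma IsDeflated.boundary_locally (hP : IsDeflated P) (hA : IsClosed (closedRegion P)) {x : Plane}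
    (hx : x ∈ P.boundary ℝ) (hxE : x ∈ closure (closedRegion P)ᶜ) :
    ∃ r > 0, P.boundary ℝ ∩ Metric.ball x r ⊆ closure (closedRegion P)ᶜ := by
  obtain ⟨r, hr, h⟩ := exists_ball_edges P x
  refine ⟨r, hr, ?_⟩
  have hne : (Metric.ball x r ∩ (closedRegion P)ᶜ).Nonempty :=
    mem_closure_iff.1 hxE _ Metric.isOpen_ball (Metric.mem_ball_self hr)
  by_cases hv : ∃ k, x = P k
  · obtain ⟨k, rfl⟩ := hv
    -- Naming the vertex as the successor of `l` makes the edges numbered `l` and `k` the two edges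
    -- at it.
    obtain ⟨l, rfl⟩ := (finRotate n).surjective k
    set k := finRotate n l
    have hB : P.boundary ℝ ∩ Metric.ball (P k) r ⊆
        segment ℝ (P k) (P (finRotate n k)) ∪ segment ℝ (P l) (P k) := by
      rintro y ⟨hy, hyr⟩
      obtain ⟨i, hi⟩ := Set.mem_iUnion.1 hy
      have hk := h y hyr i hi
      rw [← edgeSet_eq, ← edgeSet_eq]
      rcases eq_or_ne i k with rfl | hik
      · exact Or.inl hi
      · obtain ⟨k', e, -, h'⟩ := hP.simple.edges_meet k i hik.symm (P k)
          ⟨vertex_mem_edgeSet P k, hk⟩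
        obtain rfl := hP.simple.injective e
        rcases h' with h' | h'
        · exact absurd h'.symm hik
        · rw [(finRotate n).injective h']
          exact Or.inr hi
    rcases (hP.orient_consecutive_ne_zero l).lt_or_gt with h0 | h0
    · refine boundary_near_corner (a := P l) (b := P (finRotate n k)) hr ?_ ?_ hA hne
      · rw [orient_swap_right]; linarith
      · rw [segment_symm ℝ (P k) (P l), segment_symm ℝ (P (finRotate n k)), Set.union_comm]
        exact hB
    · exact boundary_near_corner hr h0 hB hA hne
  · obtain ⟨i, hi⟩ := Set.mem_iUnion.1 hx
    refine boundary_near_edge (a := P i) (b := P (finRotate n i))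
      (fun e => (hP.simple.adj_succ i).1 (hP.simple.injective e)) ?_ hA hne
    rintro y ⟨hy, hyr⟩
    obtain ⟨j, hj⟩ := Set.mem_iUnion.1 hy
    have hxj := h y hyr j hj
    rw [← edgeSet_eq]
    by_cases hij : i = j
    · rw [hij]; exact hj
    · obtain ⟨k, e, -⟩ := hP.simple.edges_meet i j hij x ⟨hi, hxj⟩
      exact absurd ⟨k, e⟩ hv

/-- Every boundary point of a deflated polygon is a limit of points outside. -/
theorem IsDeflated.boundary_subset_closure_compl (hP : IsDeflated P)
    (hA : IsClosed (closedRegion P)) (hne : (closedRegion P)ᶜ.Nonempty) :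
    P.boundary ℝ ⊆ closure (closedRegion P)ᶜ := by
  choose! r hr hrB using fun x (hx : x ∈ P.boundary ℝ ∩ closure (closedRegion P)ᶜ) =>
    hP.boundary_locally hA hx.1 hx.2
  set F := P.boundary ℝ ∩ closure (closedRegion P)ᶜ
  -- If the outside touched no boundary point, it would be clopen and hence the whole plane.
  have hF : F.Nonempty := by
    by_contra! hF
    have hcl : IsClopen (closedRegion P)ᶜ := by
      refine ⟨isClosed_of_closure_subset fun x hx => ?_, hA.isOpen_compl⟩
      have hxB : x ∉ P.boundary ℝ := fun h => by
        have : x ∈ F := ⟨h, hx⟩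
        rw [hF] at this; exact this
      obtain ⟨ε, hε, hb⟩ := Metric.isOpen_iff.1 (isClosed_boundary P).isOpen_compl x hxB
      exact subset_compl_closedRegion (convex_ball x ε).isPreconnected hb
        (mem_closure_iff.1 hx _ Metric.isOpen_ball (Metric.mem_ball_self hε))
        (Metric.mem_ball_self hε)
    have huniv := hcl.eq_univ hne
    have h3 := hP.simple.three_le
    have h0 : P ⟨0, by omega⟩ ∈ (closedRegion P)ᶜ := huniv ▸ Set.mem_univ _
    exact h0 (boundary_subset_closedRegion P (vertex_mem_boundary P _))
  set U := ⋃ x ∈ F, Metric.ball x (r x)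
  have hUo : IsOpen U := isOpen_biUnion fun x _ => Metric.isOpen_ball
  have hU : P.boundary ℝ ∩ U ⊆ closure (closedRegion P)ᶜ := by
    rintro y ⟨hy, hyU⟩
    obtain ⟨x, hx, hyx⟩ := Set.mem_iUnion₂.1 hyU
    exact hrB x hx ⟨hy, hyx⟩
  -- `F` is relatively closed in the boundary, and `hU` makes it relatively open; the boundary is
  -- connected.
  have hpre := isPreconnected_iff_subset_of_disjoint.1 (isPreconnected_boundary P) U
    (closure (closedRegion P)ᶜ)ᶜ hUo isClosed_closure.isOpen_compl
    (fun x hx => ?_) ?_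
  · rcases hpre with h | h
    · exact fun x hx => hU ⟨hx, h hx⟩
    · obtain ⟨x, hx⟩ := hF
      exact absurd hx.2 (h hx.1)
  · by_cases hxc : x ∈ closure (closedRegion P)ᶜ
    · exact Or.inl (Set.mem_iUnion₂.2 ⟨x, ⟨hx, hxc⟩, Metric.mem_ball_self (hr x ⟨hx, hxc⟩)⟩)
    · exact Or.inr hxc
  · rw [Set.eq_empty_iff_forall_notMem]
    rintro x ⟨hx, hxU, hxc⟩
    exact hxc (hU ⟨hx, hxU⟩)

variable {T : Finset (Finset (Fin n))}

/-! ### Triangles of a triangulation -/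

/-- `a, b, c` are the corners of a triangle of `T` in counter-clockwise order. -/
def Tri (P : Polygon Plane n) (T : Finset (Finset (Fin n))) (a b c : Fin n) : Prop :=
  {a, b, c} ∈ T ∧ 0 < orient (P a) (P b) (P c)

lemma rotate_eq {α : Type*} [DecidableEq α] (a b c : α) : ({b, c, a} : Finset α) = {a, b, c} := by
  ext x; simp only [Finset.mem_insert, Finset.mem_singleton]; tauto

lemma Tri.rotate {a b c : Fin n} (h : Tri P T a b c) : Tri P T b c a :=
  ⟨by rw [rotate_eq]; exact h.1, by rw [orient_rotate]; exact h.2⟩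

lemma Tri.ne_left {a b c : Fin n} (h : Tri P T a b c) : a ≠ b := by
  rintro rfl
  have := h.2
  simp [orient] at this

lemma Tri.ne_right {a b c : Fin n} (h : Tri P T a b c) : b ≠ c := h.rotate.ne_left

lemma Tri.ne_outer {a b c : Fin n} (h : Tri P T a b c) : c ≠ a := h.rotate.rotate.ne_left

lemma hull_eq (a b c : Fin n) : hull P {a, b, c} = convexHull ℝ {P a, P b, P c} := by
  simp [hull, Set.image_insert_eq]

lemma Tri.mem_hull {a b c : Fin n} (h : Tri P T a b c) {x : Plane} : x ∈ hull P {a, b, c} ↔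
    0 ≤ orient (P a) (P b) x ∧ 0 ≤ orient (P b) (P c) x ∧ 0 ≤ orient (P c) (P a) x := by
  rw [hull_eq, mem_convexHull_triangle h.2]

lemma vertex_mem_hull {t : Finset (Fin n)} {a : Fin n} (h : a ∈ t) : P a ∈ hull P t :=
  subset_convexHull _ _ ⟨a, h, rfl⟩

lemma segment_subset_hull {t : Finset (Fin n)} {x y : Plane} (hx : x ∈ hull P t)
    (hy : y ∈ hull P t) : segment ℝ x y ⊆ hull P t := (convex_convexHull _ _).segment_subset hx hy

/-- The open triangle with corners `a`, `b`, `c`. -/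
def inner (P : Polygon Plane n) (a b c : Fin n) : Set Plane := openTriangle (P a) (P b) (P c)

lemma isOpen_inner (a b c : Fin n) : IsOpen (inner P a b c) := isOpen_openTriangle _ _ _

lemma Tri.inner_subset_interior {a b c : Fin n} (h : Tri P T a b c) :
    inner P a b c ⊆ interior (hull P {a, b, c}) := by
  rw [hull_eq]; exact openTriangle_subset_interior h.2

/-- An odd permutation of the corners would reverse the sign of the orientation, so only rotations
remain. -/
lemma Tri.eq_cases {a b c a' b' c' : Fin n} (h : Tri P T a b c) (h' : Tri P T a' b' c')
    (e : ({a, b, c} : Finset (Fin n)) = {a', b', c'}) :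
    (a' = a ∧ b' = b ∧ c' = c) ∨ (a' = b ∧ b' = c ∧ c' = a) ∨ (a' = c ∧ b' = a ∧ c' = b) := by
  have ha : a' ∈ ({a, b, c} : Finset (Fin n)) := by rw [e]; simp
  have hb : b' ∈ ({a, b, c} : Finset (Fin n)) := by rw [e]; simp
  have hc : c' ∈ ({a, b, c} : Finset (Fin n)) := by rw [e]; simp
  simp only [Finset.mem_insert, Finset.mem_singleton] at ha hb hc
  have h1 := h'.ne_left
  have h2 := h'.ne_right
  have h3 := h'.ne_outer
  have g := h.2
  have g' := h'.2
  have s1 : orient (P b) (P a) (P c) = -orient (P a) (P b) (P c) := orient_swap _ _ _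
  have s2 : orient (P a) (P c) (P b) = -orient (P a) (P b) (P c) := orient_swap_right _ _ _
  have s3 : orient (P c) (P b) (P a) = -orient (P a) (P b) (P c) := by
    rw [orient_rotate, orient_swap_right]
  rcases ha with rfl | rfl | rfl <;> rcases hb with rfl | rfl | rfl <;>
    rcases hc with rfl | rfl | rfl <;> first | (exact absurd rfl ‹_›) | tauto | linarith

namespace IsTriangulation

lemma exists_tri (hP : IsDeflated P) (hT : IsTriangulation P T) {t : Finset (Fin n)}
    (ht : t ∈ T) : ∃ a b c, t = {a, b, c} ∧ Tri P T a b c := by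
  obtain ⟨a, b, c, hab, hac, hbc, rfl⟩ := Finset.card_eq_three.1 (hT.card_eq t ht)
  rcases lt_trichotomy (orient (P a) (P b) (P c)) 0 with h | h | h
  · refine ⟨b, a, c, Finset.insert_comm _ _ _, ?_, ?_⟩
    · rw [Finset.insert_comm]; exact ht
    · rw [orient_swap]; linarith
  -- A flat triangle lies on the line through `P a` and `P b`, but from an interior point one can
  -- move a little along the normal.
  · exfalso
    obtain ⟨x, hx⟩ := hT.nondegenerate _ ht
    obtain ⟨w, k, hk, hw⟩ := exists_normal (fun e => hab (hP.simple.injective e))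
    have hsub : ∀ y ∈ hull P {a, b, c}, orient (P a) (P b) y ≤ 0 := by
      intro y hy
      rw [hull_eq] at hy
      have hcv : Convex ℝ {y | orient (P a) (P b) y ≤ 0} := by
        convert convex_orient_nonneg (P b) (P a) using 3 with y
        rw [orient_swap]; simp
      refine convexHull_min ?_ hcv hy
      rintro y (rfl | rfl | rfl) <;> simp [orient_self_left, orient_self_right, h]
    have hsub' : ∀ y ∈ hull P {a, b, c}, 0 ≤ orient (P a) (P b) y := by
      intro y hy
      rw [hull_eq] at hy
      refine convexHull_min ?_ (convex_orient_nonneg _ _) hy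
      rintro y (rfl | rfl | rfl) <;> simp [orient_self_left, orient_self_right, h]
    have h0 := hsub' x (interior_subset hx)
    have := closure_inter_of_ray (K := {y | 0 < orient (P a) (P b) y}) (w := w)
      isOpen_interior hx (fun ε hε => by
        simp only [Set.mem_ofPred_eq, hw]; positivity)
    obtain ⟨y, hy, hy'⟩ := closure_nonempty_iff.1 ⟨x, this⟩
    exact (hsub y (interior_subset hy)).not_gt hy'
  · exact ⟨a, b, c, rfl, ht, h⟩

lemma hull_subset (hT : IsTriangulation P T) {t : Finset (Fin n)} (ht : t ∈ T) :
    hull P t ⊆ closedRegion P := by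
  rw [← hT.cover]; exact Set.subset_biUnion_of_mem ht

lemma isCompact_hull (t : Finset (Fin n)) : IsCompact (hull P t) :=
  (t.finite_toSet.image _).isCompact_convexHull ℝ

lemma isCompact_closedRegion (hT : IsTriangulation P T) : IsCompact (closedRegion P) := by
  rw [← hT.cover]
  exact T.finite_toSet.isCompact_biUnion fun t _ => isCompact_hull t

/-- The region is compact, so it has an outside, and this accumulates at every boundary point. Here
the triangulation supplies the closedness that the topological argument needs. -/
lemma boundary_not_mem_interior (hP : IsDeflated P) (hT : IsTriangulation P T) {x : Plane}
    (hx : x ∈ P.boundary ℝ) : x ∉ interior (closedRegion P) := by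
  have hne : (closedRegion P)ᶜ.Nonempty := by
    rw [Set.nonempty_compl]
    exact hT.isCompact_closedRegion.ne_univ
  have := hP.boundary_subset_closure_compl hT.isCompact_closedRegion.isClosed hne hx
  rwa [closure_compl] at this

end IsTriangulation

/-! ### How triangles meet visible segments, vertices and each other. -/

lemma Tri.boundary_not_mem_inner {a b c : Fin n} (h : Tri P T a b c) (hP : IsDeflated P)
    (hT : IsTriangulation P T) {x : Plane} (hx : x ∈ P.boundary ℝ) : x ∉ inner P a b c :=
  fun hi => hT.boundary_not_mem_interior hP hx
    (interior_mono (hT.hull_subset h.1) (h.inner_subset_interior hi))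

lemma Tri.adj {a b c : Fin n} (h : Tri P T a b c) (hT : IsTriangulation P T) :
    (visibilityGraph P).Adj a b :=
  ⟨h.ne_left, (segment_subset_hull (vertex_mem_hull (by simp)) (vertex_mem_hull (by simp))).trans
    (hT.hull_subset h.1)⟩

lemma segment_cases {x y z : Plane} (h : z ∈ segment ℝ x y) :
    z = x ∨ z = y ∨ z ∈ openSegment ℝ x y := by
  rw [← insert_endpoints_openSegment] at h
  simpa using h

/-- If a point of a visible segment is in a triangle but not in its interior, then the segment is
an edge of the triangle. -/
lemma Tri.edge_of_mem {a b c v w : Fin n} (h : Tri P T a b c) (hP : IsDeflated P)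
    (hT : IsTriangulation P T) (hvw : (visibilityGraph P).Adj v w) {x : Plane}
    (hx : x ∈ openSegment ℝ (P v) (P w)) (hxt : x ∈ hull P {a, b, c}) (hxi : x ∉ inner P a b c) :
    s(v, w) = s(a, b) ∨ s(v, w) = s(b, c) ∨ s(v, w) = s(c, a) := by
  rw [hull_eq] at hxt
  have key : ∀ {a b c : Fin n}, Tri P T a b c → x ∈ segment ℝ (P a) (P b) → s(v, w) = s(a, b) := by
    intro a b c h hx'
    rcases segment_cases hx' with rfl | rfl | h'
    · exact absurd hx (hP.not_mem_openSegment hvw _)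
    · exact absurd hx (hP.not_mem_openSegment hvw _)
    · by_contra hne
      exact Set.disjoint_left.1 (hP.no_crossing v w a b hvw (h.adj hT) hne) hx h'
  rcases mem_openTriangle_or_segment h.2 hxt with h' | h' | h' | h'
  · exact absurd h' hxi
  · exact Or.inl (key h h')
  · exact Or.inr (Or.inl (key h.rotate h'))
  · exact Or.inr (Or.inr (key h.rotate.rotate h'))

/-- Any other vertex in the triangle would be a boundary point in its interior or a vertex inside a
visible segment. -/
lemma Tri.vertex_of_mem {a b c k : Fin n} (h : Tri P T a b c) (hP : IsDeflated P)
    (hT : IsTriangulation P T) (hk : P k ∈ hull P {a, b, c}) : k = a ∨ k = b ∨ k = c := by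
  rw [hull_eq] at hk
  have key : ∀ {a b c : Fin n}, Tri P T a b c → P k ∈ segment ℝ (P a) (P b) → k = a ∨ k = b := by
    intro a b c h hx
    rcases segment_cases hx with e | e | h'
    · exact Or.inl (hP.simple.injective e)
    · exact Or.inr (hP.simple.injective e)
    · exact absurd h' (hP.not_mem_openSegment (h.adj hT) _)
  rcases mem_openTriangle_or_segment h.2 hk with h' | h' | h' | h'
  · exact absurd h' (h.boundary_not_mem_inner hP hT (vertex_mem_boundary P k))
  · have := key h h'; tauto
  · have := key h.rotate h'; tauto
  · have := key h.rotate.rotate h'; tauto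

lemma Tri.inner_nonempty {a b c : Fin n} (h : Tri P T a b c) : (inner P a b c).Nonempty := by
  have := openTriangle_inter_nonempty h.2 h.2
  rwa [Set.inter_self] at this

/-- A point of one triangle is not in the interior of another one. -/
lemma Tri.eq_of_mem_inner {a b c a' b' c' : Fin n} (h : Tri P T a b c) (h' : Tri P T a' b' c')
    (hT : IsTriangulation P T) {x : Plane} (hx : x ∈ hull P {a, b, c})
    (hx' : x ∈ inner P a' b' c') : ({a, b, c} : Finset (Fin n)) = {a', b', c'} := by
  by_contra hne
  obtain ⟨y, hy⟩ := h.inner_nonempty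
  rw [hull_eq] at hx
  -- Interior points of the first triangle approach `x`, so some of them are in the open second
  -- triangle.
  have hxc : x ∈ closure (openSegment ℝ x y) := by
    rw [closure_openSegment]; exact left_mem_segment _ _ _
  obtain ⟨z, hz, hz'⟩ := mem_closure_iff.1 hxc _ (isOpen_inner a' b' c') hx'
  exact Set.disjoint_left.1 (hT.disjoint _ h.1 _ h'.1 hne)
    (h.inner_subset_interior (openSegment_subset_openTriangle h.2 hx hy hz'))
    (h'.inner_subset_interior hz)

/-- There is only one triangle on each side of an edge. -/
lemma Tri.unique {a b c d : Fin n} (h : Tri P T a b c) (h' : Tri P T a b d)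
    (hT : IsTriangulation P T) : c = d := by
  obtain ⟨x, hx, hx'⟩ := openTriangle_inter_nonempty h.2 h'.2
  have e := h.eq_of_mem_inner h' hT (interior_subset (h.inner_subset_interior hx)) hx'
  have h1 := h.ne_left
  have h2 := h.ne_right
  have h3 := h.ne_outer
  have := h.eq_cases h' e
  tauto

namespace IsTriangulation

/-- Triangles are finitely many closed sets, so those missing `x` also miss the beginning of the
ray; a triangle that covers a point of this beginning contains `x` too. -/
lemma exists_tri_of_eventually (hP : IsDeflated P) (hT : IsTriangulation P T) {x w : Plane}
    (h : ∀ᶠ ε in nhdsWithin (0 : ℝ) (Set.Ioi 0), x + ε • w ∈ closedRegion P) :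
    ∃ a b c, Tri P T a b c ∧ x ∈ hull P {a, b, c} ∧
      ∃ ε : ℝ, 0 < ε ∧ x + ε • w ∈ hull P {a, b, c} := by
  have ht : Filter.Tendsto (fun ε : ℝ => x + ε • w) (nhdsWithin 0 (Set.Ioi 0)) (nhds x) := by
    have : Continuous fun ε : ℝ => x + ε • w := by fun_prop
    simpa using (this.tendsto 0).mono_left nhdsWithin_le_nhds
  have h2 : ∀ᶠ ε in nhdsWithin (0 : ℝ) (Set.Ioi 0), ∀ t ∈ T, x + ε • w ∈ hull P t →
      x ∈ hull P t := by
    rw [Filter.eventually_all_finset]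
    intro t _
    by_cases hx : x ∈ hull P t
    · exact Filter.Eventually.of_forall fun _ _ => hx
    · filter_upwards [ht.eventually ((isCompact_hull t).isClosed.isOpen_compl.mem_nhds hx)]
        with ε h1 h3
      exact absurd h3 h1
  obtain ⟨ε, ⟨h1, h2⟩, h3⟩ := ((h.and h2).and self_mem_nhdsWithin).exists
  rw [← hT.cover] at h1
  obtain ⟨t, ht, hx⟩ := Set.mem_iUnion₂.1 h1
  obtain ⟨a, b, c, rfl, habc⟩ := hT.exists_tri hP ht
  exact ⟨a, b, c, habc, h2 _ ht hx, ε, h3, hx⟩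

/-- If one can go from a point `x` of an edge to its left-hand side inside the polygon, there is a
triangle on that side. -/
lemma exists_tri_left (hP : IsDeflated P) (hT : IsTriangulation P T) {a b : Fin n}
    (hab : (visibilityGraph P).Adj a b) {x w : Plane} (hx : x ∈ openSegment ℝ (P a) (P b))
    (hxi : ∀ a' b' c', Tri P T a' b' c' → x ∉ inner P a' b' c')
    (h : ∀ᶠ ε in nhdsWithin (0 : ℝ) (Set.Ioi 0), x + ε • w ∈ closedRegion P)
    (hw : 0 < orient (P a) (P b) (x + w)) : ∃ d, Tri P T a b d := by
  obtain ⟨a', b', c', h', hxt, ε, hε, hxε⟩ := hT.exists_tri_of_eventually hP h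
  have hx0 : orient (P a) (P b) x = 0 := by
    obtain ⟨s, t, -, -, hst, rfl⟩ := hx
    rw [orient_combo _ _ _ _ hst, orient_self_left, orient_self_right]; ring
  have hpos : 0 < orient (P a) (P b) (x + ε • w) := by
    have : orient (P a) (P b) (x + ε • w) =
        (1 - ε) * orient (P a) (P b) x + ε * orient (P a) (P b) (x + w) := by
      simp only [orient, PiLp.add_apply, PiLp.smul_apply, smul_eq_mul]; ring
    rw [this, hx0]; simp only [mul_zero, zero_add]; positivity
  have key : ∀ {a' b' c' : Fin n}, Tri P T a' b' c' → x + ε • w ∈ hull P {a', b', c'} →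
      s(a, b) = s(a', b') → ∃ d, Tri P T a b d := by
    intro a' b' c' h' hxε e
    rcases Sym2.eq_iff.1 e with ⟨rfl, rfl⟩ | ⟨rfl, rfl⟩
    · exact ⟨c', h'⟩
    · have := (h'.mem_hull.1 hxε).1
      rw [orient_swap] at this
      linarith
  rcases h'.edge_of_mem hP hT hab hx hxt (hxi _ _ _ h') with e | e | e
  · exact key h' hxε e
  · exact key h'.rotate (by rw [rotate_eq]; exact hxε) e
  · exact key h'.rotate.rotate (by rw [rotate_eq, rotate_eq]; exact hxε) e

/-- The midpoint of the edge lies in some triangle but, as a boundary point, not in its interior;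
`Tri.edge_of_mem` then identifies the edge. -/
lemma exists_tri_edge (hP : IsDeflated P) (hT : IsTriangulation P T) (i : Fin n) :
    (∃ c, Tri P T i (finRotate n i) c) ∨ ∃ c, Tri P T (finRotate n i) i c := by
  have hi := hP.simple.adj_succ i
  have hm := midpoint_mem_openSegment_self (P i) (P (finRotate n i))
  set x := (1 / 2 : ℝ) • P i + (1 / 2 : ℝ) • P (finRotate n i)
  have hxB : x ∈ P.boundary ℝ := edgeSet_subset_boundary P i
    (by rw [edgeSet_eq]; exact openSegment_subset_segment _ _ _ hm)
  have hxA := boundary_subset_closedRegion P hxB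
  rw [← hT.cover] at hxA
  obtain ⟨t, ht, hx⟩ := Set.mem_iUnion₂.1 hxA
  obtain ⟨a, b, c, rfl, h⟩ := hT.exists_tri hP ht
  have key : ∀ {a b c : Fin n}, Tri P T a b c → s(i, finRotate n i) = s(a, b) →
      (∃ c, Tri P T i (finRotate n i) c) ∨ ∃ c, Tri P T (finRotate n i) i c := by
    intro a b c h e
    rcases Sym2.eq_iff.1 e with ⟨e1, e2⟩ | ⟨e1, e2⟩
    · exact Or.inl ⟨c, by rw [e2, e1]; exact h⟩
    · exact Or.inr ⟨c, by rw [e2, e1]; exact h⟩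
  rcases h.edge_of_mem hP hT hi hm hx (h.boundary_not_mem_inner hP hT hxB) with e | e | e
  · exact key h e
  · exact key h.rotate e
  · exact key h.rotate.rotate e

end IsTriangulation

/-- Near `x` the inequalities of the four outer edges hold strictly, and the side of `a b` decides
which triangle contains the point. -/
lemma Tri.mem_interior_union {a b c d : Fin n} (h : Tri P T a b c) (h' : Tri P T b a d)
    {x : Plane} (hx : x ∈ openSegment ℝ (P a) (P b)) :
    x ∈ interior (hull P {a, b, c} ∪ hull P {b, a, d}) := by
  have hb := h.rotate.2
  have ha := h.rotate.rotate.2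
  have hb' := h'.rotate.rotate.2
  have ha' := h'.rotate.2
  have ho : IsOpen ({y | 0 < orient (P b) (P c) y} ∩ {y | 0 < orient (P c) (P a) y} ∩
      ({y | 0 < orient (P a) (P d) y} ∩ {y | 0 < orient (P d) (P b) y})) :=
    ((isOpen_lt continuous_const (continuous_orient _ _)).inter
      (isOpen_lt continuous_const (continuous_orient _ _))).inter
    ((isOpen_lt continuous_const (continuous_orient _ _)).inter
      (isOpen_lt continuous_const (continuous_orient _ _)))
  refine interior_maximal ?_ ho ?_
  · rintro y ⟨⟨h1, h2⟩, h3, h4⟩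
    rw [Set.mem_union, h.mem_hull, h'.mem_hull, orient_swap (P a) (P b) y]
    simp only [Set.mem_ofPred_eq] at h1 h2 h3 h4
    rcases le_total 0 (orient (P a) (P b) y) with h0 | h0
    · exact Or.inl ⟨h0, h1.le, h2.le⟩
    · exact Or.inr ⟨by linarith, h3.le, h4.le⟩
  · obtain ⟨s, t, hs, ht, hst, rfl⟩ := hx
    simp only [Set.mem_inter_iff, Set.mem_ofPred_eq, orient_combo _ _ _ _ hst, orient_self_left,
      orient_self_right, mul_zero, zero_add, add_zero]
    exact ⟨⟨by positivity, by positivity⟩, by positivity, by positivity⟩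

/-- A polygon edge does not have triangles on both sides. -/
lemma Tri.not_boundary {a b c d i : Fin n} (h : Tri P T a b c) (h' : Tri P T b a d)
    (hP : IsDeflated P) (hT : IsTriangulation P T) : s(a, b) ≠ s(i, finRotate n i) := by
  intro e
  have hm := midpoint_mem_openSegment_self (P a) (P b)
  refine hT.boundary_not_mem_interior hP (edgeSet_subset_boundary P i ?_)
    (interior_mono (Set.union_subset (hT.hull_subset h.1) (hT.hull_subset h'.1))
      (h.mem_interior_union h' hm))
  rw [edgeSet_eq]
  have := openSegment_subset_segment _ _ _ hm
  rcases Sym2.eq_iff.1 e with ⟨rfl, rfl⟩ | ⟨rfl, rfl⟩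
  · exact this
  · rwa [segment_symm]

/-- An edge of a triangle that is not a polygon edge has a triangle on its other side. -/
lemma Tri.exists_opposite {a b c : Fin n} (h : Tri P T a b c) (hP : IsDeflated P)
    (hT : IsTriangulation P T) (hne : ∀ i, s(a, b) ≠ s(i, finRotate n i)) :
    ∃ d, Tri P T b a d := by
  have hab := h.adj hT
  have hm := midpoint_mem_openSegment_self (P a) (P b)
  set x := (1 / 2 : ℝ) • P a + (1 / 2 : ℝ) • P b
  have hxB : x ∉ P.boundary ℝ := by
    intro hx
    obtain ⟨i, hi⟩ := Set.mem_iUnion.1 hx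
    rw [edgeSet_eq] at hi
    rcases segment_cases hi with e | e | hi
    · exact hP.not_mem_openSegment hab _ (e ▸ hm)
    · exact hP.not_mem_openSegment hab _ (e ▸ hm)
    · exact Set.disjoint_left.1 (hP.no_crossing _ _ _ _ hab (hP.simple.adj_succ i) (hne i)) hm hi
  have hxA : x ∈ openRegion P :=
    (hab.2 (openSegment_subset_segment _ _ _ hm)).resolve_left hxB
  have hx0 : orient (P a) (P b) x = 0 := by
    simp only [x]
    rw [orient_combo _ _ _ _ (by norm_num), orient_self_left, orient_self_right]; ring
  have hxt : x ∈ hull P {a, b, c} :=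
    segment_subset_hull (vertex_mem_hull (by simp)) (vertex_mem_hull (by simp))
      (openSegment_subset_segment _ _ _ hm)
  -- The midpoint is in the open polygon, so every direction is free; `P a - P c` leads to the side
  -- of `a b` away from `c`.
  refine hT.exists_tri_left (x := x) (w := P a - P c) hP hab.symm (by rwa [openSegment_symm])
    (fun a' b' c' h' hi => ?_) ?_ ?_
  · have e := h.eq_of_mem_inner h' hT hxt hi
    obtain ⟨i1, i2, i3⟩ := hi
    rcases h.eq_cases h' e with ⟨rfl, rfl, rfl⟩ | ⟨rfl, rfl, rfl⟩ | ⟨rfl, rfl, rfl⟩ <;> linarith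
  · have ht : Filter.Tendsto (fun ε : ℝ => x + ε • (P a - P c)) (nhdsWithin 0 (Set.Ioi 0))
        (nhds x) := by
      have : Continuous fun ε : ℝ => x + ε • (P a - P c) := by fun_prop
      simpa using (this.tendsto 0).mono_left nhdsWithin_le_nhds
    filter_upwards [ht.eventually (isOpen_openRegion.mem_nhds hxA)] with ε hε
    exact Or.inr hε
  · have : orient (P b) (P a) (x + (P a - P c)) =
        -orient (P a) (P b) x + orient (P a) (P b) (P c) := by
      simp only [orient, PiLp.add_apply, PiLp.sub_apply]; ring
    rw [this, hx0]
    have := h.2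
    linarith

/-- One cannot cross a polygon edge inside the polygon. -/
lemma IsTriangulation.not_cross (hP : IsDeflated P) (hT : IsTriangulation P T) {i : Fin n}
    {x w : Plane} (hx : x ∈ openSegment ℝ (P i) (P (finRotate n i)))
    (h : ∀ᶠ ε in nhdsWithin (0 : ℝ) (Set.Ioi 0), x + ε • w ∈ closedRegion P)
    (h' : ∀ᶠ ε in nhdsWithin (0 : ℝ) (Set.Ioi 0), x + ε • (-w) ∈ closedRegion P)
    (hw : orient (P i) (P (finRotate n i)) (x + w) ≠ 0) : False := by
  have hi := hP.simple.adj_succ i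
  have hxB : x ∈ P.boundary ℝ := edgeSet_subset_boundary P i
    (by rw [edgeSet_eq]; exact openSegment_subset_segment _ _ _ hx)
  have hxi : ∀ a' b' c', Tri P T a' b' c' → x ∉ inner P a' b' c' :=
    fun a' b' c' h => h.boundary_not_mem_inner hP hT hxB
  have hx0 : orient (P i) (P (finRotate n i)) x = 0 := by
    obtain ⟨s, t, -, -, hst, rfl⟩ := hx
    rw [orient_combo _ _ _ _ hst, orient_self_left, orient_self_right]; ring
  have hneg : orient (P i) (P (finRotate n i)) (x + -w) =
      2 * orient (P i) (P (finRotate n i)) x - orient (P i) (P (finRotate n i)) (x + w) := by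
    simp only [orient, PiLp.add_apply, PiLp.neg_apply]; ring
  have hx' : x ∈ openSegment ℝ (P (finRotate n i)) (P i) := by rwa [openSegment_symm]
  rcases hw.lt_or_gt with h0 | h0
  · obtain ⟨c, hc⟩ := hT.exists_tri_left hP hi.symm hx' hxi h (by rw [orient_swap]; linarith)
    obtain ⟨d, hd⟩ := hT.exists_tri_left hP hi hx hxi h' (by linarith)
    exact hd.not_boundary hc hP hT rfl
  · obtain ⟨c, hc⟩ := hT.exists_tri_left hP hi.symm hx' hxi h' (by rw [orient_swap]; linarith)
    obtain ⟨d, hd⟩ := hT.exists_tri_left hP hi hx hxi h (by linarith)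
    exact hd.not_boundary hc hP hT rfl

/-- The quadrilateral formed by two adjacent triangles is not convex. -/
lemma Tri.reflex {z p q y : Fin n} (h : Tri P T z p q) (h' : Tri P T p y q) (hP : IsDeflated P)
    (hT : IsTriangulation P T) :
    orient (P z) (P p) (P y) < 0 ∨ orient (P y) (P q) (P z) < 0 := by
  by_contra! hn
  obtain ⟨h1, h2⟩ := hn
  have hz : 0 < orient (P p) (P q) (P z) := h.rotate.2
  have hy : orient (P p) (P q) (P y) < 0 := by
    rw [orient_swap_right]; have := h'.2; linarith
  have hyz : y ≠ z := by rintro rfl; linarith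
  -- `m` is where `y z` meets the line `p q`. As neither `p` nor `q` is reflex, it lies on the
  -- segment `p q`; so `y` and `z` see each other through it and the two diagonals cross.
  obtain ⟨m, hm, hm0⟩ := exists_mem_openSegment_orient_eq_zero (P p) (P q) hy hz
  have hmpq : m ∈ segment ℝ (P p) (P q) := by
    obtain ⟨s, t, hs, ht, hst, rfl⟩ := hm
    refine mem_segment_of_orient_eq_zero hz hm0 ?_ ?_
    · rw [orient_combo _ _ _ _ hst, orient_self_right, orient_rotate]
      have := mul_nonneg hs.le h2; linarith
    · rw [orient_combo _ _ _ _ hst, orient_self_left]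
      have := mul_nonneg hs.le h1; linarith
  have hadj : (visibilityGraph P).Adj y z := by
    refine ⟨hyz, (segment_subset_union hm).trans (Set.union_subset ?_ ?_)⟩
    · refine (segment_subset_hull (t := {p, y, q}) (vertex_mem_hull (by simp)) ?_).trans
        (hT.hull_subset h'.1)
      exact segment_subset_hull (vertex_mem_hull (by simp)) (vertex_mem_hull (by simp)) hmpq
    · refine (segment_subset_hull (t := {z, p, q}) ?_ (vertex_mem_hull (by simp))).trans
        (hT.hull_subset h.1)
      exact segment_subset_hull (vertex_mem_hull (by simp)) (vertex_mem_hull (by simp)) hmpq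
  rcases segment_cases hmpq with rfl | rfl | hmo
  · exact hP.not_mem_openSegment hadj _ hm
  · exact hP.not_mem_openSegment hadj _ hm
  · refine Set.disjoint_left.1 (hP.no_crossing _ _ _ _ hadj (h.rotate.adj hT) ?_) hm hmo
    intro e
    rcases Sym2.eq_iff.1 e with ⟨e, -⟩ | ⟨e, -⟩
    · exact h'.ne_left e.symm
    · exact h'.ne_right e

/-! ### The triangles around a vertex -/

/-- A vertex seen from a corner `v` of a triangle does not lie strictly between the directions of
the two other corners. -/
lemma Tri.not_adj_between {v a b w : Fin n} (h : Tri P T v a b) (hP : IsDeflated P)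
    (hT : IsTriangulation P T) (hw : (visibilityGraph P).Adj v w)
    (ha : orient (P v) (P w) (P a) < 0) (hb : 0 < orient (P v) (P w) (P b)) : False := by
  have hwa : w ≠ a := by rintro rfl; rw [orient_self_right] at ha; exact ha.false
  have hwb : w ≠ b := by rintro rfl; rw [orient_self_right] at hb; exact hb.false
  -- Within the angle at `v`, the vertex `w` is either in the triangle, hence a corner, or beyond `a
  -- b`, and then `v w` crosses `a b`.
  rcases le_or_gt 0 (orient (P a) (P b) (P w)) with h0 | h0
  · have hmem : P w ∈ hull P {v, a, b} := by
      rw [h.mem_hull, ← orient_rotate (P b) (P v) (P w)]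
      refine ⟨?_, h0, hb.le⟩
      rw [orient_swap_right]; linarith
    rcases h.vertex_of_mem hP hT hmem with e | e | e
    · exact hw.1 e.symm
    · exact hwa e
    · exact hwb e
  · obtain ⟨m, hm, hm0⟩ := exists_mem_openSegment_orient_eq_zero (P v) (P w) ha hb
    have hvw : P v ≠ P w := fun e => hw.1 (hP.simple.injective e)
    obtain ⟨s, hs⟩ := exists_ray hvw hm0
    have hm1 : orient (P a) (P b) m = 0 := by
      obtain ⟨s, t, -, -, hst, rfl⟩ := hm
      rw [orient_combo _ _ _ _ hst, orient_self_left, orient_self_right]; ring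
    have hv : 0 < orient (P a) (P b) (P v) := h.rotate.2
    rw [hs, orient_ray] at hm1
    have hs0 : 0 < s := by
      by_contra! hn
      have := mul_nonneg_of_nonpos_of_nonpos hn (sub_neg.2 (h0.trans hv)).le
      linarith
    have hs1 : s < 1 := by
      by_contra! hn
      have := mul_le_mul_of_nonpos_right hn (sub_neg.2 (h0.trans hv)).le
      linarith
    have hmo := ray_mem_openSegment (P v) (P w) hs0 hs1
    rw [← hs, one_smul, add_sub_cancel] at hmo
    refine Set.disjoint_left.1 (hP.no_crossing _ _ _ _ hw (h.rotate.adj hT) ?_) hmo hm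
    intro e
    rcases Sym2.eq_iff.1 e with ⟨e, -⟩ | ⟨e, -⟩
    · exact h.ne_left e
    · exact h.ne_outer e.symm

/-- Two vertices seen from `v` on a line through `v` are on different sides of `v`. -/
lemma IsDeflated.ray_neg (hP : IsDeflated P) {v w a : Fin n} (hw : (visibilityGraph P).Adj v w)
    (ha : (visibilityGraph P).Adj v a) (hwa : a ≠ w) (h : orient (P v) (P w) (P a) = 0) :
    ∃ s : ℝ, s < 0 ∧ P a = P v + s • (P w - P v) := by
  have hvw : P v ≠ P w := fun e => hw.1 (hP.simple.injective e)
  obtain ⟨s, hs⟩ := exists_ray hvw h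
  refine ⟨s, ?_, hs⟩
  by_contra! h0
  rcases h0.eq_or_lt with rfl | h0
  · rw [zero_smul, add_zero] at hs
    exact ha.1 (hP.simple.injective hs.symm)
  rcases lt_trichotomy s 1 with h1 | rfl | h1
  · have := ray_mem_openSegment (P v) (P w) h0 h1
    rw [← hs, one_smul, add_sub_cancel] at this
    exact hP.not_mem_openSegment hw a this
  · rw [one_smul, add_sub_cancel] at hs
    exact hwa (hP.simple.injective hs)
  · have := ray_mem_openSegment (P v) (P w) one_pos h1
    rw [← hs, one_smul, add_sub_cancel] at this
    exact hP.not_mem_openSegment ha w this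

/-- The counter-clockwise order of the directions at `v`, starting with the direction of `w`. -/
def Before (P : Polygon Plane n) (v w a b : Fin n) : Prop :=
  SignType.sign (orient (P v) (P w) (P b)) < SignType.sign (orient (P v) (P w) (P a)) ∨
  (SignType.sign (orient (P v) (P w) (P b)) = SignType.sign (orient (P v) (P w) (P a)) ∧
    orient (P v) (P w) (P b) ≠ 0 ∧ 0 < orient (P v) (P a) (P b))

lemma Before.irrefl (v w a : Fin n) : ¬ Before P v w a a := by
  rintro (h | ⟨-, -, h⟩)
  · exact h.false
  · rw [orient_self_right] at h; exact h.false

lemma Before.trans {v w a b c : Fin n} (h1 : Before P v w a b) (h2 : Before P v w b c) :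
    Before P v w a c := by
  rcases h1 with h1 | ⟨e1, n1, o1⟩ <;> rcases h2 with h2 | ⟨e2, n2, o2⟩
  · exact Or.inl (h2.trans h1)
  · exact Or.inl (e2 ▸ h1)
  · exact Or.inl (e1 ▸ h2)
  · refine Or.inr ⟨e2.trans e1, n2, ?_⟩
    -- The three-term relation at `v`; the three values of `orient (P v) (P w)` in it have the same
    -- sign.
    have key : orient (P v) (P a) (P c) * orient (P v) (P w) (P b) =
        orient (P v) (P a) (P b) * orient (P v) (P w) (P c) +
        orient (P v) (P b) (P c) * orient (P v) (P w) (P a) := by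
      simp only [orient]; ring
    rcases n1.lt_or_gt with hb | hb
    · rw [sign_neg hb] at e1 e2
      have ha := sign_eq_neg_one_iff.1 e1.symm
      have hc := sign_eq_neg_one_iff.1 e2
      have := mul_neg_of_pos_of_neg o1 hc
      have := mul_neg_of_pos_of_neg o2 ha
      by_contra! hn
      have := mul_nonneg_of_nonpos_of_nonpos hn hb.le
      linarith
    · rw [sign_pos hb] at e1 e2
      have ha := sign_eq_one_iff.1 e1.symm
      have hc := sign_eq_one_iff.1 e2
      have := mul_pos o1 hc
      have := mul_pos o2 ha
      by_contra! hn
      have := mul_nonpos_of_nonpos_of_nonneg hn hb.le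
      linarith

lemma Before.wellFounded (v w : Fin n) : WellFounded (Before P v w) := by
  have : IsTrans (Fin n) (Before P v w) := ⟨fun _ _ _ => Before.trans⟩
  have : Std.Irrefl (Before P v w) := ⟨Before.irrefl v w⟩
  exact Finite.wellFounded_of_trans_of_irrefl _

lemma Before.wellFounded_swap (v w : Fin n) :
    WellFounded (Function.swap (Before P v w)) := by
  have : IsTrans (Fin n) (Function.swap (Before P v w)) := ⟨fun _ _ _ h h' => Before.trans h' h⟩
  have : Std.Irrefl (Function.swap (Before P v w)) := ⟨Before.irrefl v w⟩
  exact Finite.wellFounded_of_trans_of_irrefl _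

/-- The direction of `w` is not strictly inside the angle of the triangle (`Tri.not_adj_between`),
nor along its sides (`IsDeflated.ray_neg`), so turning from `a` to `b` does not pass the starting
direction. This is what makes turning around a vertex terminate. -/
lemma Tri.before {v w a b : Fin n} (h : Tri P T v a b) (hP : IsDeflated P)
    (hT : IsTriangulation P T) (hw : (visibilityGraph P).Adj v w) (ha : a ≠ w) (hb : b ≠ w) :
    Before P v w a b := by
  have hva := h.adj hT
  have hvb := (h.rotate.rotate.adj hT).symm
  have ho := h.2
  have hexp : ∀ (c : Plane) (s : ℝ),
      orient (P v) (P v + s • (P w - P v)) c = s * orient (P v) (P w) c := by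
    intro c s
    simp only [orient, PiLp.add_apply, PiLp.smul_apply, PiLp.sub_apply, smul_eq_mul]; ring
  rcases lt_trichotomy (orient (P v) (P w) (P a)) 0 with h1 | h1 | h1 <;>
    rcases lt_trichotomy (orient (P v) (P w) (P b)) 0 with h2 | h2 | h2
  · exact Or.inr ⟨by rw [sign_neg h1, sign_neg h2], h2.ne, ho⟩
  · obtain ⟨s, hs, e⟩ := hP.ray_neg hw hvb hb h2
    rw [orient_swap_right, e, hexp] at ho
    have := mul_pos_of_neg_of_neg hs h1
    linarith
  · exact (h.not_adj_between hP hT hw h1 h2).elim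
  · exact Or.inl (by rw [sign_neg h2, h1, sign_zero]; decide)
  · obtain ⟨s, hs, e⟩ := hP.ray_neg hw hvb hb h2
    rw [orient_swap_right, e, hexp, h1] at ho
    simp at ho
  · obtain ⟨s, hs, e⟩ := hP.ray_neg hw hva ha h1
    rw [e, hexp] at ho
    have := mul_neg_of_neg_of_pos hs h2
    linarith
  · exact Or.inl (by rw [sign_neg h2, sign_pos h1]; decide)
  · exact Or.inl (by rw [h2, sign_pos h1, sign_zero]; decide)
  · exact Or.inr ⟨by rw [sign_pos h1, sign_pos h2], h2.ne', ho⟩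

/-- `v a` is an edge of the triangulation. -/
def Nbr (P : Polygon Plane n) (T : Finset (Finset (Fin n))) (v a : Fin n) : Prop :=
  ∃ b, Tri P T v a b ∨ Tri P T v b a

lemma Nbr.exists_succ {v a : Fin n} (h : Nbr P T v a) (hP : IsDeflated P)
    (hT : IsTriangulation P T) (hn : ∀ i, s(v, a) ≠ s(i, finRotate n i)) :
    ∃ b, Tri P T v a b := by
  obtain ⟨b, h | h⟩ := h
  · exact ⟨b, h⟩
  · exact h.rotate.rotate.exists_opposite hP hT (fun i => by rw [Sym2.eq_swap]; exact hn i)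

lemma Nbr.exists_pred {v a : Fin n} (h : Nbr P T v a) (hP : IsDeflated P)
    (hT : IsTriangulation P T) (hn : ∀ i, s(v, a) ≠ s(i, finRotate n i)) :
    ∃ b, Tri P T v b a := by
  obtain ⟨b, h | h⟩ := h
  · obtain ⟨d, hd⟩ := h.exists_opposite hP hT hn
    exact ⟨d, hd.rotate⟩
  · exact ⟨b, h⟩

lemma Tri.not_pred_of_boundary {v a b c i : Fin n} (h : Tri P T v a b) (h' : Tri P T v c a)
    (hP : IsDeflated P) (hT : IsTriangulation P T) : s(v, a) ≠ s(i, finRotate n i) :=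
  h.not_boundary h'.rotate.rotate hP hT

lemma boundary_nbr {v a i : Fin n} (h : s(v, a) = s(i, finRotate n i)) :
    a = finRotate n v ∨ a = (finRotate n).symm v := by
  rcases Sym2.eq_iff.1 h with ⟨rfl, rfl⟩ | ⟨rfl, rfl⟩
  · exact Or.inl rfl
  · exact Or.inr (Equiv.symm_apply_apply _ _).symm

/-- Turn counter-clockwise around `v` as long as a triangle follows. Angles are measured from the
polygon edge `v w`, which has a triangle on one side only, so a turn that arrives at `w` stops
there. `Nbr.exists_first` is the clockwise version. -/
lemma Nbr.exists_last {v a : Fin n} (h : Nbr P T v a) (hP : IsDeflated P)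
    (hT : IsTriangulation P T) :
    ∃ e, Nbr P T v e ∧ ∀ b, ¬ Tri P T v e b := by
  set w := finRotate n v
  have hw := hP.simple.adj_succ v
  have key : ∀ a, a ≠ w → Nbr P T v a → ∃ e, Nbr P T v e ∧ ∀ b, ¬ Tri P T v e b := by
    intro a
    induction a using (Before.wellFounded_swap (P := P) v w).induction with
    | _ a ih =>
      intro haw ha
      by_cases hs : ∃ b, Tri P T v a b
      · obtain ⟨b, hb⟩ := hs
        rcases eq_or_ne b w with rfl | hbw
        · exact ⟨w, ⟨a, Or.inr hb⟩, fun c hc => hc.not_pred_of_boundary hb hP hT rfl⟩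
        · exact ih b (hb.before hP hT hw haw hbw) hbw ⟨a, Or.inr hb⟩
      · push Not at hs
        exact ⟨a, ha, hs⟩
  by_cases haw : a = w
  · by_cases hs : ∃ b, Tri P T v a b
    · obtain ⟨b, hb⟩ := hs
      exact key b (fun e => hb.ne_right (haw.trans e.symm)) ⟨a, Or.inr hb⟩
    · push Not at hs
      exact ⟨a, h, hs⟩
  · exact key a haw h

lemma Nbr.exists_first {v a : Fin n} (h : Nbr P T v a) (hP : IsDeflated P)
    (hT : IsTriangulation P T) :
    ∃ e, Nbr P T v e ∧ (∀ b, ¬ Tri P T v b e) ∧ Relation.ReflTransGen (Tri P T v) e a := by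
  set w := finRotate n v
  have hw := hP.simple.adj_succ v
  have key : ∀ a, a ≠ w → Nbr P T v a →
      ∃ e, Nbr P T v e ∧ (∀ b, ¬ Tri P T v b e) ∧ Relation.ReflTransGen (Tri P T v) e a := by
    intro a
    induction a using (Before.wellFounded (P := P) v w).induction with
    | _ a ih =>
      intro haw ha
      by_cases hs : ∃ b, Tri P T v b a
      · obtain ⟨b, hb⟩ := hs
        rcases eq_or_ne b w with rfl | hbw
        · exact ⟨w, ⟨a, Or.inl hb⟩, fun c hc => hb.not_pred_of_boundary hc hP hT rfl,
            Relation.ReflTransGen.single hb⟩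
        · obtain ⟨e, h1, h2, h3⟩ := ih b (hb.before hP hT hw hbw haw) hbw ⟨a, Or.inl hb⟩
          exact ⟨e, h1, h2, h3.tail hb⟩
      · push Not at hs
        exact ⟨a, ha, hs, Relation.ReflTransGen.refl⟩
  by_cases haw : a = w
  · by_cases hs : ∃ b, Tri P T v b a
    · obtain ⟨b, hb⟩ := hs
      obtain ⟨e, h1, h2, h3⟩ := key b (fun e => hb.ne_right (e.trans haw.symm)) ⟨a, Or.inl hb⟩
      exact ⟨e, h1, h2, h3.tail hb⟩
    · push Not at hs
      exact ⟨a, h, hs, Relation.ReflTransGen.refl⟩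
  · exact key a haw h

/-- The triangles at a vertex form a single fan: all edges at `v` are reached from a first one by
rotating counter-clockwise from triangle to triangle. -/
theorem IsTriangulation.exists_fan (hP : IsDeflated P) (hT : IsTriangulation P T) (v : Fin n) :
    ∃ e, ∀ a, Nbr P T v a → Relation.ReflTransGen (Tri P T v) e a := by
  have hbd : ∀ a, (∃ i, s(v, a) = s(i, finRotate n i)) →
      a = finRotate n v ∨ a = (finRotate n).symm v := fun a ⟨i, hi⟩ => boundary_nbr hi
  have hw : Nbr P T v (finRotate n v) := by
    rcases hT.exists_tri_edge hP v with ⟨c, hc⟩ | ⟨c, hc⟩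
    · exact ⟨c, Or.inl hc⟩
    · exact ⟨c, Or.inr hc.rotate⟩
  obtain ⟨e, he, hne, -⟩ := hw.exists_first hP hT
  refine ⟨e, fun a ha => ?_⟩
  obtain ⟨e', he', hne', hchain⟩ := ha.exists_first hP hT
  suffices e' = e by rwa [this] at hchain
  by_contra hee
  have hfirst : ∀ e, Nbr P T v e → (∀ b, ¬ Tri P T v b e) →
      e = finRotate n v ∨ e = (finRotate n).symm v := by
    intro e he hne
    refine hbd e ?_
    by_contra! hn
    obtain ⟨b, hb⟩ := he.exists_pred hP hT hn
    exact hne b hb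
  obtain ⟨l, hl, hnl⟩ := hw.exists_last hP hT
  have hl' : l = finRotate n v ∨ l = (finRotate n).symm v := by
    refine hbd l ?_
    by_contra! hn
    obtain ⟨b, hb⟩ := hl.exists_succ hP hT hn
    exact hnl b hb
  -- First and last edges at `v` are polygon edges, and there are only two of these at `v`. Two
  -- different first edges use up both, so the last edge is one of them and has no triangle on
  -- either side.
  have hle : l = e ∨ l = e' := by
    rcases hfirst e he hne with h | h <;> rcases hfirst e' he' hne' with h' | h' <;>
      rcases hl' with h'' | h'' <;> simp_all
  obtain ⟨b, hb | hb⟩ := hl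
  · exact hnl b hb
  · rcases hle with rfl | rfl
    · exact hne b hb
    · exact hne' b hb

/-! ### Nodes of the dual tree -/

/-- The node of the triangle `a b c`. -/
def Tri.node {a b c : Fin n} (h : Tri P T a b c) : Node T := Sum.inl ⟨{a, b, c}, h.1⟩

lemma Tri.node_rotate {a b c : Fin n} (h : Tri P T a b c) : h.rotate.node = h.node := by
  simp only [Tri.node, rotate_eq]

lemma mem_nodeEdges_inl {t : {t // t ∈ T}} {a b : Fin n} :
    s(a, b) ∈ nodeEdges (Sum.inl t : Node T) ↔ a ≠ b ∧ a ∈ t.1 ∧ b ∈ t.1 := by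
  simp [nodeEdges]

lemma mem_nodeEdges_inr {i a b : Fin n} :
    s(a, b) ∈ nodeEdges (Sum.inr i : Node T) ↔ s(a, b) = s(i, finRotate n i) := Iff.rfl

lemma Tri.mem_nodeEdges {a b c : Fin n} (h : Tri P T a b c) : s(a, b) ∈ nodeEdges h.node :=
  mem_nodeEdges_inl.2 ⟨h.ne_left, by simp, by simp⟩

lemma Tri.mem_nodeEdges₂ {a b c : Fin n} (h : Tri P T a b c) : s(b, c) ∈ nodeEdges h.node :=
  mem_nodeEdges_inl.2 ⟨h.ne_right, by simp, by simp⟩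

lemma Tri.mem_nodeEdges₃ {a b c : Fin n} (h : Tri P T a b c) : s(c, a) ∈ nodeEdges h.node :=
  mem_nodeEdges_inl.2 ⟨h.ne_outer, by simp, by simp⟩

lemma IsTriangulation.exists_tri_of_mem (hP : IsDeflated P) (hT : IsTriangulation P T)
    {t : Finset (Fin n)} (ht : t ∈ T) {a b : Fin n} (ha : a ∈ t) (hb : b ∈ t) (hab : a ≠ b) :
    ∃ d, (t = {a, b, d} ∧ Tri P T a b d) ∨ (t = {b, a, d} ∧ Tri P T b a d) := by
  obtain ⟨x, y, z, rfl, h⟩ := hT.exists_tri hP ht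
  have r1 := rotate_eq x y z
  have r2 := rotate_eq y z x
  simp only [Finset.mem_insert, Finset.mem_singleton] at ha hb
  rcases ha with rfl | rfl | rfl <;> rcases hb with rfl | rfl | rfl
  · exact absurd rfl hab
  · exact ⟨z, Or.inl ⟨rfl, h⟩⟩
  · exact ⟨y, Or.inr ⟨by rw [← r1, ← r2], h.rotate.rotate⟩⟩
  · exact ⟨z, Or.inr ⟨rfl, h⟩⟩
  · exact absurd rfl hab
  · exact ⟨x, Or.inl ⟨by rw [r1], h.rotate⟩⟩
  · exact ⟨y, Or.inl ⟨by rw [← r1, ← r2], h.rotate.rotate⟩⟩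
  · exact ⟨x, Or.inr ⟨by rw [r1], h.rotate⟩⟩
  · exact absurd rfl hab

lemma Tri.across_cases {a b c : Fin n} (h : Tri P T a b c) (hP : IsDeflated P)
    (hT : IsTriangulation P T) {x : Node T} (hx : x ≠ h.node) (he : s(a, b) ∈ nodeEdges x) :
    (∃ i, x = Sum.inr i ∧ s(a, b) = s(i, finRotate n i)) ∨
      ∃ (d : Fin n) (h' : Tri P T b a d), x = h'.node := by
  rcases x with ⟨t, ht⟩ | i
  · right
    obtain ⟨hab, ha, hb⟩ := mem_nodeEdges_inl.1 he
    obtain ⟨d, ⟨e, h'⟩ | ⟨e, h'⟩⟩ := hT.exists_tri_of_mem hP ht ha hb hab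
    · obtain rfl := h.unique h' hT
      subst e
      exact absurd rfl hx
    · subst e
      exact ⟨d, h', rfl⟩
  · exact Or.inl ⟨i, rfl, he⟩

lemma Tri.node_ne_opposite {a b c d : Fin n} (h : Tri P T a b c) (h' : Tri P T b a d) :
    h'.node ≠ h.node := by
  intro e
  have e' : ({b, a, d} : Finset (Fin n)) = {a, b, c} := congrArg Subtype.val (Sum.inl.inj e)
  have := h.ne_left
  have := h.ne_right
  have := h.ne_outer
  have := h'.eq_cases h e'
  tauto

lemma Tri.exists_across {a b c : Fin n} (h : Tri P T a b c) (hP : IsDeflated P)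
    (hT : IsTriangulation P T) : ∃ x : Node T, x ≠ h.node ∧ s(a, b) ∈ nodeEdges x := by
  by_cases hb : ∃ i, s(a, b) = s(i, finRotate n i)
  · obtain ⟨i, hi⟩ := hb
    exact ⟨Sum.inr i, by simp [Tri.node], hi⟩
  · push Not at hb
    obtain ⟨d, hd⟩ := h.exists_opposite hP hT hb
    exact ⟨hd.node, h.node_ne_opposite hd, by rw [Sym2.eq_swap]; exact hd.mem_nodeEdges⟩

lemma edge_injective (hn : 3 ≤ n) {i j : Fin n}
    (h : s(i, finRotate n i) = s(j, finRotate n j)) : i = j := by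
  rcases Sym2.eq_iff.1 h with ⟨h, -⟩ | ⟨h, h'⟩
  · exact h
  · rw [h] at h'
    exact absurd h' (finRotate_finRotate_ne hn j)

lemma Tri.across_unique {a b c : Fin n} (h : Tri P T a b c) (hP : IsDeflated P)
    (hT : IsTriangulation P T) {x y : Node T} (hx : x ≠ h.node) (he : s(a, b) ∈ nodeEdges x)
    (hy : y ≠ h.node) (he' : s(a, b) ∈ nodeEdges y) : x = y := by
  rcases h.across_cases hP hT hx he with ⟨i, rfl, hi⟩ | ⟨d, hd, rfl⟩ <;>
    rcases h.across_cases hP hT hy he' with ⟨j, rfl, hj⟩ | ⟨d', hd', rfl⟩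
  · rw [edge_injective hP.simple.three_le (hi.symm.trans hj)]
  · exact absurd hi (h.not_boundary hd' hP hT)
  · exact absurd hj (h.not_boundary hd hP hT)
  · obtain rfl := hd.unique hd' hT
    rfl

/-- Different triangles share at most one edge. -/
lemma Tri.not_two_edges {a b c : Fin n} (h : Tri P T a b c) (hT : IsTriangulation P T)
    {x : Node T} (hx : x ≠ h.node) (h1 : s(a, b) ∈ nodeEdges x) (h2 : s(b, c) ∈ nodeEdges x) :
    False := by
  rcases x with ⟨t, ht⟩ | i
  · obtain ⟨-, ha, hb⟩ := mem_nodeEdges_inl.1 h1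
    obtain ⟨-, -, hc⟩ := mem_nodeEdges_inl.1 h2
    refine hx ?_
    have : ({a, b, c} : Finset (Fin n)) = t := by
      refine Finset.eq_of_subset_of_card_le ?_ ?_
      · intro y hy
        simp only [Finset.mem_insert, Finset.mem_singleton] at hy
        rcases hy with rfl | rfl | rfl <;> assumption
      · rw [hT.card_eq t ht, hT.card_eq _ h.1]
    subst this
    rfl
  · have e := (mem_nodeEdges_inr.1 h1).trans (mem_nodeEdges_inr.1 h2).symm
    rcases Sym2.eq_iff.1 e with ⟨e, -⟩ | ⟨e, -⟩
    · exact h.ne_left e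
    · exact h.ne_outer e.symm

/-- Positive orientation fixes the labelling of each triangle up to rotation and the common edge
fixes the rotations, so any witness of `RightReflex` uses the given labels. -/
lemma Tri.rightReflex_iff {z p q y : Fin n} (h : Tri P T z p q) (h' : Tri P T p y q) :
    RightReflex P {z, p, q} {p, y, q} ↔ orient (P z) (P p) (P y) < 0 := by
  refine ⟨?_, fun hn => ⟨z, p, q, y, rfl, rfl, h.2, h'.2, hn⟩⟩
  rintro ⟨u, v, w, x, e1, e2, o1, o2, o3⟩
  have g1 : Tri P T u v w := ⟨e1 ▸ h.1, o1⟩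
  have g2 : Tri P T v x w := ⟨e2 ▸ h'.1, o2⟩
  have zy : z ≠ y := by
    rintro rfl
    have h1 := h.2
    have h2 := h'.2
    rw [orient_swap] at h1
    linarith
  have := h.ne_left
  have := h.ne_right
  have := h.ne_outer
  have := h'.ne_left
  have := h'.ne_right
  rcases h.eq_cases g1 e1 with ⟨rfl, rfl, rfl⟩ | ⟨rfl, rfl, rfl⟩ | ⟨rfl, rfl, rfl⟩ <;>
    rcases h'.eq_cases g2 e2 with ⟨e3, e4, e5⟩ | ⟨e3, e4, e5⟩ | ⟨e3, e4, e5⟩ <;>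
    first
    | (subst e4; exact o3)
    | (exfalso; simp_all)

lemma Tri.ccw_intro {a b c : Fin n} (h : Tri P T a b c) {x y z : Node T} (hx : x ≠ h.node)
    (hy : y ≠ h.node) (hz : z ≠ h.node) (ex : s(a, b) ∈ nodeEdges x) (ey : s(b, c) ∈ nodeEdges y)
    (ez : s(c, a) ∈ nodeEdges z) : (directedDual P T).ccw h.node x y z :=
  ⟨⟨{a, b, c}, h.1⟩, a, b, c, rfl, rfl, h.2, hx, hy, hz, ex, ey, ez⟩

/-- As `x` shares only the edge `a b` with the triangle (`Tri.not_two_edges`), the labelling hidden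
in `ccw` cannot be a nontrivial rotation of `a, b, c`. -/
lemma Tri.ccw_elim {a b c : Fin n} (h : Tri P T a b c) (hT : IsTriangulation P T) {x y z : Node T}
    (hc : (directedDual P T).ccw h.node x y z) (ex : s(a, b) ∈ nodeEdges x) :
    x ≠ h.node ∧ y ≠ h.node ∧ z ≠ h.node ∧ s(b, c) ∈ nodeEdges y ∧ s(c, a) ∈ nodeEdges z := by
  obtain ⟨t, p, q, r, e, e', o, hx, hy, hz, e1, e2, e3⟩ := hc
  refine ⟨hx, hy, hz, ?_⟩
  obtain rfl : (⟨{a, b, c}, h.1⟩ : {t // t ∈ T}) = t := Sum.inl.inj e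
  simp only at e'
  have h' : Tri P T p q r := ⟨e' ▸ h.1, o⟩
  rcases h.eq_cases h' e' with ⟨rfl, rfl, rfl⟩ | ⟨rfl, rfl, rfl⟩ | ⟨rfl, rfl, rfl⟩
  · exact ⟨e2, e3⟩
  · exact (h.not_two_edges hT hx ex e1).elim
  · exact (h.rotate.rotate.not_two_edges hT (by rw [h.rotate.node_rotate, h.node_rotate]; exact hx)
      e1 ex).elim

/-! ### Visibility paths as an inductive relation -/

/-- `D.Leads a b g`: a visibility path starts with `a`, `b` and ends at `g`. -/
inductive DirectedPlaneGraph.Leads {N : Type} (D : DirectedPlaneGraph N) : N → N → N → Prop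
  | last (a b : N) : a ∉ D.terminal → D.graph.Adj a b → b ∈ D.terminal → D.Leads a b b
  | step (a b c r l g : N) : a ∉ D.terminal → D.graph.Adj a b → b ∉ D.terminal →
      D.ccw b a r l → (D.arrow b a ∧ c = r ∨ D.arrow a b ∧ c = l) → D.Leads b c g → D.Leads a b g

namespace DirectedPlaneGraph

variable {N : Type} {D : DirectedPlaneGraph N}

/-- `Leads` records adjacency at every step, a visibility path only at its start; `hD` supplies the
rest. -/
lemma IsVisibilityPath.leads (hD : ∀ b a r l, D.ccw b a r l → D.graph.Adj b r ∧ D.graph.Adj b l)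
    {g : N} : ∀ (x : List N) (a b : N), D.IsVisibilityPath (a :: b :: x) →
      (a :: b :: x).getLast? = some g → D.Leads a b g
  | [], a, b, h, hg => by
    have hb : b ∈ D.terminal := by
      by_contra hb
      obtain ⟨h2, -⟩ := h.step 0 (by simp) hb
      simp at h2
    simp at hg
    subst hg
    exact .last a b h.start h.start_adj hb
  | c :: x, a, b, h, hg => by
    have hb : b ∉ D.terminal := by
      intro hb
      have := h.terminal_last 0 (by simp) hb
      simp at this
    obtain ⟨_, r, l, hc, hor⟩ := h.step 0 (by simp) hb
    have hbc : D.graph.Adj b c := by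
      rcases hor with ⟨-, e⟩ | ⟨-, e⟩
      · have : c = r := e
        rw [this]; exact (hD _ _ _ _ hc).1
      · have : c = l := e
        rw [this]; exact (hD _ _ _ _ hc).2
    refine .step a b c r l g h.start h.start_adj hb hc hor
      (IsVisibilityPath.leads hD x b c ⟨by simp, hb, hbc, fun i hi ht => ?_, fun i hi ht => ?_⟩
        (by simpa using hg))
    · have := h.terminal_last (i + 1) (by simpa using hi) ht
      simpa using this
    · obtain ⟨hi', r, l, h1, h2⟩ := h.step (i + 1) (by simpa using hi) ht
      exact ⟨by simpa using hi', r, l, h1, h2⟩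

lemma Leads.exists_path {a b g : N} (h : D.Leads a b g) :
    ∃ x : List N, D.IsVisibilityPath (a :: b :: x) ∧ (a :: b :: x).getLast? = some g := by
  induction h with
  | last a b ha hab hb =>
    refine ⟨[], ⟨by simp, ha, hab, fun i hi _ => ?_, fun i hi ht => ?_⟩, by simp⟩
    · simp at hi ⊢; omega
    · simp at hi; subst hi; exact absurd hb ht
  | step a b c r l g ha hab hb hc hor _ ih =>
    obtain ⟨x, hx, hg⟩ := ih
    refine ⟨c :: x, ⟨by simp, ha, hab, fun i hi ht => ?_, fun i hi ht => ?_⟩, by simpa using hg⟩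
    · cases i with
      | zero => exact absurd ht hb
      | succ i => simpa using hx.terminal_last i (by simpa using hi) ht
    · cases i with
      | zero => exact ⟨by simp, r, l, hc, hor⟩
      | succ i =>
        obtain ⟨hi', r, l, h1, h2⟩ := hx.step i (by simpa using hi) ht
        exact ⟨by simpa using hi', r, l, h1, h2⟩

lemma exists_path_iff (hD : ∀ b a r l, D.ccw b a r l → D.graph.Adj b r ∧ D.graph.Adj b l)
    (a g : N) : (∃ x : List N, D.IsVisibilityPath x ∧ x.head? = some a ∧ x.getLast? = some g) ↔
      ∃ b, D.Leads a b g := by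
  constructor
  · rintro ⟨x, hx, ha, hg⟩
    match x, hx, ha, hg with
    | [], hx, _, _ => exact absurd hx.two_le (by simp)
    | [_], hx, _, _ => exact absurd hx.two_le (by simp)
    | a' :: b :: x, hx, ha, hg =>
      obtain rfl : a' = a := by simpa using ha
      exact ⟨b, hx.leads hD x a' b hg⟩
  · rintro ⟨b, h⟩
    obtain ⟨x, hx, hg⟩ := h.exists_path
    exact ⟨_, hx, by simp, hg⟩

end DirectedPlaneGraph

/-! ### Sight lines -/

lemma directedDual_ccw_adj (b a r l : Node T) (h : (directedDual P T).ccw b a r l) :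
    (directedDual P T).graph.Adj b r ∧ (directedDual P T).graph.Adj b l := by
  obtain ⟨t, p, q, s, rfl, e, o, -, hr, hl, -, h2, h3⟩ := h
  have hT : Tri P T p q s := ⟨e ▸ t.2, o⟩
  refine ⟨⟨hr.symm, _, mem_nodeEdges_inl.2 ⟨hT.ne_right, ?_, ?_⟩, h2⟩,
    ⟨hl.symm, _, mem_nodeEdges_inl.2 ⟨hT.ne_outer, ?_, ?_⟩, h3⟩⟩ <;> simp [e]

lemma Tri.arrow_iff {z p q y : Fin n} (h : Tri P T z p q) (h' : Tri P T p y q) :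
    (directedDual P T).arrow h.node h'.node ↔ orient (P z) (P p) (P y) < 0 := by
  rw [← h.rightReflex_iff h']
  constructor
  · rintro ⟨a, b, e1, e2, h3⟩
    obtain rfl := Sum.inl.inj e1
    obtain rfl := Sum.inl.inj e2
    exact h3
  · exact fun h3 => ⟨⟨_, h.1⟩, ⟨_, h'.1⟩, rfl, rfl, h3⟩

lemma Tri.arrow_iff' {z p q y : Fin n} (h : Tri P T z p q) (h' : Tri P T p y q) :
    (directedDual P T).arrow h'.node h.node ↔ orient (P y) (P q) (P z) < 0 := by
  rw [← h'.rotate.arrow_iff h.rotate.rotate, h'.node_rotate, h.rotate.node_rotate, h.node_rotate]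

lemma Tri.node_not_terminal {a b c : Fin n} (h : Tri P T a b c) :
    h.node ∉ (directedDual P T).terminal := by
  rintro ⟨i, hi⟩
  exact Sum.inr_ne_inl hi

/-- The ray from `u` through the point `c` reaches the edge `p q` of the triangle `z p q` from the
side of `z` without leaving the polygon, and not before `c`; the corner `z` is not farther from the
line of the ray than the endpoint of the edge on the same side. -/
structure Sight (P : Polygon Plane n) (T : Finset (Finset (Fin n))) (u : Fin n) (c : Plane)
    (z p q : Fin n) : Prop where
  tri : Tri P T z p q
  right_le : orient (P u) c (P p) ≤ orient (P u) c (P z)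
  le_left : orient (P u) c (P z) ≤ orient (P u) c (P q)
  right_nonpos : orient (P u) c (P p) ≤ 0
  left_nonneg : 0 ≤ orient (P u) c (P q)
  lt : orient (P u) c (P p) < orient (P u) c (P q)
  see : ∃ s : ℝ, 1 ≤ s ∧ P u + s • (c - P u) ∈ segment ℝ (P p) (P q) ∧
    segment ℝ (P u) (P u + s • (c - P u)) ⊆ closedRegion P

/-- No vertex on the ray from `u` through `c` strictly behind `c` is visible from `u`. -/
def Clear (P : Polygon Plane n) (u : Fin n) (c : Plane) : Prop :=
  ∀ (y : Fin n) (s : ℝ), 1 < s → P y = P u + s • (c - P u) →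
    ¬ segment ℝ (P u) (P y) ⊆ closedRegion P

lemma orient_ray_edge (u c p q : Plane) (s s' : ℝ) :
    orient p q (u + s' • (c - u)) = orient p q (u + s • (c - u)) -
      (s' - s) * (orient u c q - orient u c p) := by
  simp only [orient, PiLp.add_apply, PiLp.smul_apply, PiLp.sub_apply, smul_eq_mul]; ring

lemma orient_of_mem_segment {p q m : Plane} (hm : m ∈ segment ℝ p q) : orient p q m = 0 := by
  obtain ⟨s, t, -, -, hst, rfl⟩ := hm
  rw [orient_combo _ _ _ _ hst, orient_self_left, orient_self_right]; ring

lemma Sight.ne {u : Fin n} {c : Plane} {z p q : Fin n} (h : Sight P T u c z p q) : P u ≠ c := by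
  rintro rfl
  have := h.lt
  simp [orient] at this

/-- Behind the edge `p q`, the ray enters the next triangle `p y q`; it leaves it through the edge
opposite to the reflex vertex. -/
lemma Sight.next {u : Fin n} {c : Plane} {z p q y : Fin n} (h : Sight P T u c z p q)
    (hb : Tri P T p y q) (hP : IsDeflated P) (hT : IsTriangulation P T) (hc : Clear P u c) :
    (orient (P u) c (P y) < 0 ∧ orient (P z) (P p) (P y) < 0 ∧ 0 ≤ orient (P y) (P q) (P z) ∧
      orient (P u) c (P y) < orient (P u) c (P p) ∧ Sight P T u c p y q) ∨
    (0 < orient (P u) c (P y) ∧ orient (P y) (P q) (P z) < 0 ∧ 0 ≤ orient (P z) (P p) (P y) ∧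
      orient (P u) c (P q) < orient (P u) c (P y) ∧ Sight P T u c q p y) := by
  obtain ⟨s, hs, hm, hseg⟩ := h.see
  have hm0 := orient_of_mem_segment hm
  have hy : orient (P p) (P q) (P y) < 0 := by
    rw [orient_swap_right]; have := hb.2; linarith
  have hpqz : 0 < orient (P p) (P q) (P z) := h.tri.rotate.2
  have hmh : P u + s • (c - P u) ∈ hull P {p, y, q} :=
    segment_subset_hull (vertex_mem_hull (by simp)) (vertex_mem_hull (by simp)) hm
  have hd := sub_pos.2 h.lt
  -- Points of the new triangle on the ray lie beyond `p q`, hence at parameters at least `s`, and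
  -- the piece in between stays in the triangle.
  have hsee : ∀ m ∈ hull P {p, y, q}, orient (P u) c m = 0 →
      ∃ s', s ≤ s' ∧ m = P u + s' • (c - P u) ∧ segment ℝ (P u) m ⊆ closedRegion P := by
    intro m hmh' hm'
    obtain ⟨s', rfl⟩ := exists_ray h.ne hm'
    have h1 := (hb.mem_hull.1 hmh').2.2
    rw [orient_swap, orient_ray_edge _ _ _ _ s s', hm0] at h1
    have hss : s ≤ s' := by
      by_contra! hn
      have := mul_neg_of_neg_of_pos (sub_neg.2 hn) hd
      linarith
    refine ⟨s', hss, rfl, ?_⟩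
    rcases hss.eq_or_lt with rfl | hss
    · exact hseg
    · exact (segment_subset_union (ray_mem_openSegment _ _ (by linarith) hss)).trans
        (Set.union_subset hseg ((segment_subset_hull hmh hmh').trans (hT.hull_subset hb.1)))
  have hyh : P y ∈ hull P {p, y, q} := vertex_mem_hull (by simp)
  have hph : P p ∈ hull P {p, y, q} := vertex_mem_hull (by simp)
  have hqh : P q ∈ hull P {p, y, q} := vertex_mem_hull (by simp)
  rcases lt_trichotomy (orient (P u) c (P y)) 0 with h0 | h0 | h0
  · left
    -- `q` is maximal among `z, y, q`, so it is not reflex and `p` is. Were `y` not farther to the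
    -- right than `p`, then `p` would be minimal and not reflex either.
    have hnr := orient_nonneg_of_left h.le_left h.lt (h0.le.trans h.left_nonneg) hb.2 hpqz
    have hr := (h.tri.reflex hb hP hT).resolve_right hnr.not_gt
    have hlt : orient (P u) c (P y) < orient (P u) c (P p) := by
      by_contra! hn
      exact (orient_nonneg_of_right h.right_le h.lt hn hb.2 hpqz).not_gt hr
    refine ⟨h0, hr, hnr, hlt, hb, hlt.le, h.lt.le, h0.le, h.left_nonneg, hlt.trans h.lt, ?_⟩
    obtain ⟨m, hm1, hm2⟩ :=
      exists_mem_segment_orient_eq_zero (P u) c h0.le h.left_nonneg (hlt.trans h.lt)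
    obtain ⟨s', h1, rfl, h2⟩ := hsee m (segment_subset_hull hyh hqh hm1) hm2
    exact ⟨s', hs.trans h1, hm1, h2⟩
  -- With `y` on the ray, `u` would see it. It is strictly behind `c`, since it is off the line `p
  -- q` that the ray reaches no earlier than `c`.
  · exfalso
    obtain ⟨s', h1, e, h2⟩ := hsee _ hyh h0
    refine hc y s' (lt_of_le_of_ne (hs.trans h1) ?_) e h2
    rintro rfl
    obtain rfl := le_antisymm hs h1
    rw [← e] at hm0
    exact hy.ne hm0
  · right
    have hnr := orient_nonneg_of_right h.right_le h.lt (h.right_nonpos.trans h0.le) hb.2 hpqz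
    have hr := (h.tri.reflex hb hP hT).resolve_left hnr.not_gt
    have hlt : orient (P u) c (P q) < orient (P u) c (P y) := by
      by_contra! hn
      exact (orient_nonneg_of_left h.le_left h.lt hn hb.2 hpqz).not_gt hr
    refine ⟨h0, hr, hnr, hlt, hb.rotate.rotate, h.lt.le, hlt.le, h.right_nonpos, h0.le,
      h.lt.trans hlt, ?_⟩
    obtain ⟨m, hm1, hm2⟩ :=
      exists_mem_segment_orient_eq_zero (P u) c h.right_nonpos h0.le (h.lt.trans hlt)
    obtain ⟨s', h1, rfl, h2⟩ := hsee m (segment_subset_hull hph hyh hm1) hm2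
    exact ⟨s', hs.trans h1, hm1, h2⟩

/-! ### Visibility paths lead to visible edges -/

lemma seesEdge_of_mem {p q i u : Fin n} (h : s(p, q) = s(i, finRotate n i)) {x : Plane}
    (hx : x ∈ openSegment ℝ (P p) (P q)) (hs : segment ℝ (P u) x ⊆ closedRegion P) :
    SeesEdge P u i := by
  refine ⟨x, ?_, hs⟩
  rcases Sym2.eq_iff.1 h with ⟨rfl, rfl⟩ | ⟨rfl, rfl⟩
  · exact hx
  · rwa [openSegment_symm]

lemma seesEdge_of_endpoint {u i : Fin n} (h : u = i ∨ u = finRotate n i) : SeesEdge P u i := by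
  have hm := midpoint_mem_openSegment_self (P i) (P (finRotate n i))
  refine ⟨_, hm, ?_⟩
  refine Set.Subset.trans ?_ ((edgeSet_subset_boundary P i).trans (boundary_subset_closedRegion P))
  rw [edgeSet_eq]
  refine (convex_segment _ _).segment_subset ?_ (openSegment_subset_segment _ _ _ hm)
  rcases h with rfl | rfl
  · exact left_mem_segment _ _ _
  · exact right_mem_segment _ _ _

/-- The triangle node behind an edge. -/
lemma Sight.eq_node {u : Fin n} {c : Plane} {z p q : Fin n} (h : Sight P T u c z p q)
    (hP : IsDeflated P) (hT : IsTriangulation P T) {b : Node T} (hb : b ≠ h.tri.node)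
    (he : s(p, q) ∈ nodeEdges b) : (∃ i, b = Sum.inr i ∧ s(p, q) = s(i, finRotate n i)) ∨
      ∃ (y : Fin n) (h' : Tri P T p y q), b = h'.node := by
  rcases h.tri.rotate.across_cases hP hT (by rw [Tri.node_rotate]; exact hb) he with h' | h'
  · exact Or.inl h'
  · obtain ⟨y, h', rfl⟩ := h'
    exact Or.inr ⟨y, h'.rotate, h'.node_rotate.symm⟩

/-- The ray keeps passing strictly between `p` and `q`. In each triangle `Sight.next` names a reflex
endpoint and excludes the other one, so the path is forced through the edge by which the ray leaves.
-/
lemma Sight.seesEdge_of_leads {u : Fin n} {c : Plane} (hP : IsDeflated P)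
    (hT : IsTriangulation P T) (hc : Clear P u c) {a b g : Node T}
    (hl : (directedDual P T).Leads a b g) : ∀ {z p q : Fin n} (h : Sight P T u c z p q),
      orient (P u) c (P p) < 0 → 0 < orient (P u) c (P q) → a = h.tri.node →
      s(p, q) ∈ nodeEdges b → ∃ i, g = Sum.inr i ∧ SeesEdge P u i := by
  induction hl with
  | last a b ha hab hb =>
    rintro z p q h hp hq rfl he
    obtain ⟨i, rfl⟩ := hb
    obtain ⟨s, -, hm, hs⟩ := h.see
    exact ⟨i, rfl, seesEdge_of_mem he (mem_openSegment_of_orient hp hq hm (orient_ray_self _ _ _))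
      hs⟩
  | step a b c' r l g ha hab hb hccw hor _ ih =>
    rintro z p q h hp hq rfl he
    rcases h.eq_node hP hT hab.1.symm he with ⟨i, rfl, -⟩ | ⟨y, h', rfl⟩
    · exact absurd ⟨i, rfl⟩ hb
    rw [h.tri.arrow_iff h', h.tri.arrow_iff' h'] at hor
    rw [← h'.node_rotate, ← h'.rotate.node_rotate] at hccw
    obtain ⟨-, hr, hl, er, el⟩ := h'.rotate.rotate.ccw_elim hT hccw
      (by rw [Sym2.eq_swap]; exact h.tri.mem_nodeEdges₂)
    rw [h'.rotate.node_rotate, h'.node_rotate] at hr hl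
    rcases h.next h' hP hT hc with ⟨h0, h1, h2, -, h3⟩ | ⟨h0, h1, h2, -, h3⟩
    · rcases hor with ⟨hn, -⟩ | ⟨-, rfl⟩
      · exact absurd hn h2.not_gt
      · exact ih h3 h0 hq rfl el
    · rcases hor with ⟨-, rfl⟩ | ⟨hn, -⟩
      · exact ih h3 hp h0 (by rw [← h'.node_rotate, ← h'.rotate.node_rotate]) er
      · exact absurd hn h2.not_gt

lemma IsTriangulation.exists_tri_corner (hP : IsDeflated P) (hT : IsTriangulation P T)
    {t : Finset (Fin n)} (ht : t ∈ T) {u : Fin n} (hu : u ∈ t) :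
    ∃ p q, t = {u, p, q} ∧ Tri P T u p q := by
  obtain ⟨x, y, z, rfl, h⟩ := hT.exists_tri hP ht
  have r1 := rotate_eq x y z
  have r2 := rotate_eq y z x
  simp only [Finset.mem_insert, Finset.mem_singleton] at hu
  rcases hu with rfl | rfl | rfl
  · exact ⟨y, z, rfl, h⟩
  · exact ⟨z, x, r1.symm, h.rotate⟩
  · exact ⟨x, y, by rw [← r1, ← r2], h.rotate.rotate⟩

/-- A neighbour of the triangle `u p q` lies across `p q` or across an edge at `u`. -/
lemma Tri.edge_cases {u p q : Fin n} (h : Tri P T u p q) {b : Node T}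
    (hb : (directedDual P T).graph.Adj h.node b) :
    s(p, q) ∈ nodeEdges b ∨ ∃ w, w ≠ u ∧ s(u, w) ∈ nodeEdges b := by
  obtain ⟨-, e, he, he'⟩ := hb
  induction e with
  | _ v w =>
    obtain ⟨hvw, hv, hw⟩ := mem_nodeEdges_inl.1 he
    simp only [Finset.mem_insert, Finset.mem_singleton] at hv hw
    by_cases hvu : v = u
    · subst hvu; exact Or.inr ⟨w, hvw.symm, he'⟩
    by_cases hwu : w = u
    · subst hwu; exact Or.inr ⟨v, hvw, by rwa [Sym2.eq_swap]⟩
    · left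
      rcases hv with hv | rfl | rfl <;> rcases hw with hw | rfl | rfl <;>
        first | exact absurd ‹_› hvu | exact absurd ‹_› hwu | exact absurd rfl hvw |
          exact he' | (rw [Sym2.eq_swap]; exact he')

/-- The ray from a corner `u` of a triangle through a point of the opposite edge. -/
lemma Tri.sight_of_mem {u p q : Fin n} (h : Tri P T u p q) (hP : IsDeflated P)
    (hT : IsTriangulation P T) {c : Plane} (hc : c ∈ openSegment ℝ (P p) (P q)) :
    Sight P T u c u p q ∧ orient (P u) c (P p) < 0 ∧ 0 < orient (P u) c (P q) ∧ Clear P u c := by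
  have hp : orient (P u) c (P p) < 0 := by
    obtain ⟨s, t, hs, ht, hst, rfl⟩ := hc
    rw [orient_swap_right, orient_combo _ _ _ _ hst, orient_self_right]
    have := mul_pos ht h.2
    linarith
  have hq : 0 < orient (P u) c (P q) := by
    obtain ⟨s, t, hs, ht, hst, rfl⟩ := hc
    rw [orient_swap_right, orient_combo _ _ _ _ hst, orient_self_right, orient_swap_right]
    have := mul_pos hs h.2
    linarith
  have hcs := openSegment_subset_segment _ _ _ hc
  have hcA : segment ℝ (P u) c ⊆ closedRegion P :=
    (segment_subset_hull (vertex_mem_hull (by simp)) (segment_subset_hull (vertex_mem_hull (by simp))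
      (vertex_mem_hull (by simp)) hcs)).trans (hT.hull_subset h.1)
  refine ⟨⟨h, ?_, ?_, hp.le, hq.le, hp.trans hq, 1, le_rfl, ?_, ?_⟩, hp, hq, ?_⟩
  · rw [orient_self_left]; exact hp.le
  · rw [orient_self_left]; exact hq.le
  · rwa [one_smul, add_sub_cancel]
  · rwa [one_smul, add_sub_cancel]
  -- A vertex seen behind `c` would give a visible segment crossing the edge `p q` at `c`.
  · intro y s hs e hA
    have hcy : c ∈ openSegment ℝ (P u) (P y) := by
      have := ray_mem_openSegment (P u) c one_pos hs
      rwa [← e, one_smul, add_sub_cancel] at this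
    have huy : u ≠ y := by
      rintro rfl
      rw [openSegment_same, Set.mem_singleton_iff] at hcy
      rw [hcy, orient_swap_right, orient_self_left] at hp
      linarith
    refine Set.disjoint_left.1 (hP.no_crossing u y p q ⟨huy, hA⟩ (h.rotate.adj hT) ?_) hcy hc
    intro e
    rcases Sym2.eq_iff.1 e with ⟨e, -⟩ | ⟨e, -⟩
    · exact h.ne_left e
    · exact h.ne_outer e.symm

/-- A visibility path from a triangle with corner `u` leads to an edge visible from `u`. -/
theorem seesEdge_of_leads (hP : IsDeflated P) (hT : IsTriangulation P T) {u : Fin n}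
    {a b g : Node T} (hl : (directedDual P T).Leads a b g) :
    ∀ t : {t // t ∈ T}, a = Sum.inl t → u ∈ t.1 → ∃ i, g = Sum.inr i ∧ SeesEdge P u i := by
  -- If the first step crosses the edge opposite `u`, the ray through its midpoint follows the path.
  -- Otherwise the second node has `u` as a corner or endpoint too.
  have main : ∀ {a b : Node T}, (directedDual P T).Leads a b g → (directedDual P T).graph.Adj a b →
      ∀ t : {t // t ∈ T}, a = Sum.inl t → u ∈ t.1 → (∃ i, g = Sum.inr i ∧ SeesEdge P u i) ∨
        ∃ w, w ≠ u ∧ s(u, w) ∈ nodeEdges b := by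
    rintro a b hl hab ⟨t, ht⟩ rfl hu
    obtain ⟨p, q, rfl, h⟩ := hT.exists_tri_corner hP ht hu
    refine (h.edge_cases hab).imp_left fun he => ?_
    obtain ⟨hs, hp, hq, hc⟩ :=
      h.sight_of_mem hP hT (midpoint_mem_openSegment_self (P p) (P q))
    exact hs.seesEdge_of_leads hP hT hc hl hp hq rfl he
  induction hl with
  | last a b ha hab hb =>
    intro t ht hu
    rcases main (.last a b ha hab hb) hab t ht hu with h | ⟨w, hw, h⟩
    · exact h
    · obtain ⟨i, rfl⟩ := hb
      refine ⟨i, rfl, seesEdge_of_endpoint ?_⟩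
      rcases Sym2.eq_iff.1 (mem_nodeEdges_inr.1 h) with ⟨h, -⟩ | ⟨h, -⟩
      · exact Or.inl h
      · exact Or.inr h
  | step a b c' r l g ha hab hb hccw hor hl ih =>
    intro t ht hu
    rcases main (.step a b c' r l g ha hab hb hccw hor hl) hab t ht hu with h | ⟨w, hw, h⟩
    · exact h
    -- The first triangle can be dropped, as the second one also has the corner `u`.
    · rcases b with t' | i
      · exact ih main t' rfl (mem_nodeEdges_inl.1 h).2.1
      · exact absurd ⟨i, rfl⟩ hb

/-! ### Visible edges are reached by visibility paths -/

/-- All visibility paths that start by crossing the edge `p q` of the triangle `z p q` have a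
continuation to `g`. -/
def Good (P : Polygon Plane n) (T : Finset (Finset (Fin n))) (g : Node T) {z p q : Fin n}
    (h : Tri P T z p q) : Prop :=
  ∀ b, b ≠ h.node → s(p, q) ∈ nodeEdges b → (directedDual P T).Leads h.node b g

lemma Good.of_leads {z p q : Fin n} (h : Tri P T z p q) (hP : IsDeflated P)
    (hT : IsTriangulation P T) {g b : Node T} (hb : b ≠ h.node) (he : s(p, q) ∈ nodeEdges b)
    (hl : (directedDual P T).Leads h.node b g) : Good P T g h := by
  intro b' hb' he'
  have : b' = b := h.rotate.across_unique hP hT (by rw [h.node_rotate]; exact hb') he'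
    (by rw [h.node_rotate]; exact hb) he
  rwa [this]

lemma Good.exists_leads {z p q : Fin n} {h : Tri P T z p q} {g : Node T} (hg : Good P T g h)
    (hP : IsDeflated P) (hT : IsTriangulation P T) :
    ∃ b, (directedDual P T).Leads h.node b g := by
  obtain ⟨b, hb, he⟩ := h.rotate.exists_across hP hT
  rw [h.node_rotate] at hb
  exact ⟨b, hg b hb he⟩

/-- One step of a visibility path, read backwards: a continuation through the edge selected by the
reflex vertex is prolonged by the preceding triangle. -/
lemma Tri.good_step {z p q y : Fin n} (h : Tri P T z p q) (h' : Tri P T p y q)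
    (hP : IsDeflated P) (hT : IsTriangulation P T) {g : Node T}
    (hor : (orient (P y) (P q) (P z) < 0 ∧ Good P T g h'.rotate.rotate) ∨
      (orient (P z) (P p) (P y) < 0 ∧ Good P T g h')) : Good P T g h := by
  have hne : h'.node ≠ h.node := by
    have := h.rotate.node_ne_opposite h'.rotate.rotate
    rwa [h.node_rotate, h'.rotate.node_rotate, h'.node_rotate] at this
  refine Good.of_leads h hP hT hne (by rw [Sym2.eq_swap]; exact h'.mem_nodeEdges₃) ?_
  obtain ⟨r, hr, er⟩ := h'.exists_across hP hT
  obtain ⟨l, hl, el⟩ := h'.rotate.exists_across hP hT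
  rw [h'.node_rotate] at hl
  have hccw : (directedDual P T).ccw h'.node h.node r l := by
    have n2 : h'.rotate.rotate.node = h'.node := by rw [h'.rotate.node_rotate, h'.node_rotate]
    rw [← n2]
    exact h'.rotate.rotate.ccw_intro (by rw [n2]; exact hne.symm) (by rw [n2]; exact hr)
      (by rw [n2]; exact hl) (by rw [Sym2.eq_swap]; exact h.mem_nodeEdges₂) er el
  have hadj : (directedDual P T).graph.Adj h.node h'.node :=
    ⟨hne.symm, _, h.mem_nodeEdges₂, by rw [Sym2.eq_swap]; exact h'.mem_nodeEdges₃⟩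
  rcases hor with ⟨ho, hg⟩ | ⟨ho, hg⟩
  · refine .step _ _ r r l g h.node_not_terminal hadj h'.node_not_terminal hccw
      (Or.inl ⟨(h.arrow_iff' h').2 ho, rfl⟩) ?_
    have := hg r (by rw [h'.rotate.node_rotate, h'.node_rotate]; exact hr) er
    rwa [h'.rotate.node_rotate, h'.node_rotate] at this
  · exact .step _ _ l r l g h.node_not_terminal hadj h'.node_not_terminal hccw
      (Or.inr ⟨(h.arrow_iff h').2 ho, rfl⟩) (hg l hl el)

/-- A sight line does not cross a polygon edge. -/
lemma IsTriangulation.not_cross_ray (hP : IsDeflated P) (hT : IsTriangulation P T) {i : Fin n}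
    {u c : Plane} {s s' : ℝ} (hs : 0 < s) (hss : s < s')
    (hx : u + s • (c - u) ∈ openSegment ℝ (P i) (P (finRotate n i)))
    (hA : segment ℝ u (u + s' • (c - u)) ⊆ closedRegion P)
    (hi : orient u c (P i) ≠ orient u c (P (finRotate n i))) : False := by
  refine hT.not_cross hP hx (w := c - u) ?_ ?_ ?_
  · have : Set.Ioo (0 : ℝ) (s' - s) ∈ nhdsWithin (0 : ℝ) (Set.Ioi 0) :=
      Ioo_mem_nhdsGT (by linarith)
    filter_upwards [this] with ε hε
    rw [add_assoc, ← add_smul]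
    exact hA (ray_mem_segment u c (by linarith [hε.1]) (by linarith [hε.2]))
  · have : Set.Ioo (0 : ℝ) s ∈ nhdsWithin (0 : ℝ) (Set.Ioi 0) := Ioo_mem_nhdsGT hs
    filter_upwards [this] with ε hε
    rw [smul_neg, ← sub_eq_add_neg, add_sub_assoc, ← sub_smul]
    exact hA (ray_mem_segment u c (by linarith [hε.2]) (by linarith [hε.1]))
  · have e : u + s • (c - u) + (c - u) = u + (s + 1) • (c - u) := by
      rw [add_smul, one_smul, add_assoc]
    rw [e, orient_ray_edge _ _ _ _ s (s + 1),
      orient_of_mem_segment (openSegment_subset_segment _ _ _ hx)]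
    intro h
    apply hi
    linarith

/-- A sight line strictly through the edge `p q` that reaches the polygon edge `g` gives a
visibility path. -/
lemma Sight.good {u : Fin n} {c : Plane} {g : Fin n} {r : ℝ} (hP : IsDeflated P)
    (hT : IsTriangulation P T) (hc : Clear P u c) (hr : 0 < r)
    (hx : P u + r • (c - P u) ∈ openSegment ℝ (P g) (P (finRotate n g)))
    (hA : segment ℝ (P u) (P u + r • (c - P u)) ⊆ closedRegion P)
    (hg : orient (P u) c (P g) ≠ orient (P u) c (P (finRotate n g))) :
    ∀ (w : Fin n × Fin n) (z : Fin n) (h : Sight P T u c z w.1 w.2),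
      orient (P u) c (P w.1) < 0 → 0 < orient (P u) c (P w.2) →
      Good P T (Sum.inr g) h.tri := by
  -- `F` is the width of an edge across the ray. `Sight.next` moves one endpoint strictly outwards,
  -- so the width grows at each step; there are finitely many pairs of vertices.
  set F : Fin n × Fin n → ℝ := fun w => orient (P u) c (P w.2) - orient (P u) c (P w.1)
  have hwf : WellFounded fun a b : Fin n × Fin n => F b < F a := by
    have : IsTrans (Fin n × Fin n) fun a b => F b < F a := ⟨fun _ _ _ h h' => h'.trans h⟩
    have : Std.Irrefl fun a b : Fin n × Fin n => F b < F a := ⟨fun _ => lt_irrefl _⟩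
    exact Finite.wellFounded_of_trans_of_irrefl _
  intro w
  induction w using hwf.induction with
  | _ w ih =>
    obtain ⟨p, q⟩ := w
    intro z h hp hq
    obtain ⟨b, hb, he⟩ := h.tri.rotate.exists_across hP hT
    rw [h.tri.node_rotate] at hb
    rcases h.eq_node hP hT hb he with ⟨i, rfl, hi⟩ | ⟨y, h', rfl⟩
    · refine Good.of_leads h.tri hP hT hb he ?_
      obtain ⟨s, hs, hm, hseg⟩ := h.see
      have hmo := mem_openSegment_of_orient hp hq hm (orient_ray_self _ _ _)
      have hmi : P u + s • (c - P u) ∈ openSegment ℝ (P i) (P (finRotate n i)) := by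
        rcases Sym2.eq_iff.1 hi with ⟨e1, e2⟩ | ⟨e1, e2⟩
        · rwa [← e2, ← e1]
        · rwa [← e1, ← e2, openSegment_symm]
      have hine : orient (P u) c (P i) ≠ orient (P u) c (P (finRotate n i)) := by
        rcases Sym2.eq_iff.1 hi with ⟨e1, e2⟩ | ⟨e1, e2⟩
        · rw [← e2, ← e1]; exact (hp.trans hq).ne
        · rw [← e1, ← e2]; exact (hp.trans hq).ne'
      -- The ray meets the edge `i` at `s` and `g` at `r`. Going on beyond either would cross a
      -- polygon edge, so `s = r`, and different edges have disjoint open segments.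
      have hgi : i = g := by
        rcases lt_trichotomy s r with hsr | rfl | hsr
        · exact (hT.not_cross_ray hP (by linarith) hsr hmi hA hine).elim
        · by_contra hne
          exact Set.disjoint_left.1 (hP.no_crossing _ _ _ _ (hP.simple.adj_succ i)
            (hP.simple.adj_succ g) fun e => hne (edge_injective hP.simple.three_le e)) hmi hx
        · exact (hT.not_cross_ray hP hr hsr hx hseg hg).elim
      subst hgi
      exact .last _ _ h.tri.node_not_terminal
        ⟨hb.symm, _, h.tri.mem_nodeEdges₂, he⟩ ⟨i, rfl⟩
    · refine h.tri.good_step h' hP hT ?_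
      rcases h.next h' hP hT hc with ⟨h0, h1, -, h3, h4⟩ | ⟨h0, h1, -, h3, h4⟩
      · exact Or.inr ⟨h1, ih (y, q) (by simp only [F]; linarith) p h4 h0 hq⟩
      · exact Or.inl ⟨h1, ih (p, y) (by simp only [F]; linarith) q h4 hp h0⟩

/-- A vertex that sees an edge, but is not an endpoint of it, is not on its line. -/
lemma IsDeflated.not_collinear (hP : IsDeflated P) {u v w : Fin n}
    (h : (visibilityGraph P).Adj v w) (huv : u ≠ v) (huw : u ≠ w) {x : Plane}
    (hx : x ∈ openSegment ℝ (P v) (P w)) (hA : segment ℝ (P u) x ⊆ closedRegion P) :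
    orient (P u) x (P v) ≠ orient (P u) x (P w) := by
  intro heq
  have hux : P u ≠ x := fun e => hP.not_mem_openSegment h u (e ▸ hx)
  have h0 : orient (P u) x (P v) = 0 ∧ orient (P u) x (P w) = 0 := by
    have h1 : orient (P u) x x = 0 := orient_self_right _ _
    obtain ⟨s, t, hs, ht, hst, e⟩ := hx
    nth_rewrite 2 [← e] at h1
    rw [orient_combo _ _ _ _ hst, heq, ← add_mul, hst, one_mul] at h1
    exact ⟨heq.trans h1, h1⟩
  -- On the ray, `u, x, v, w` have the coordinates `0, 1, α, β`. With `α < 1 < β`, either `u = v`,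
  -- or one of `u`, `v` lies strictly between two vertices that see each other.
  have key : ∀ {v w : Fin n}, (visibilityGraph P).Adj v w → u ≠ v → u ≠ w →
      x ∈ openSegment ℝ (P v) (P w) → ∀ α β : ℝ, P v = P u + α • (x - P u) →
      P w = P u + β • (x - P u) → α < 1 → 1 < β → False := by
    intro v w h huv huw hx α β ev ew hα hβ
    rcases lt_trichotomy α 0 with h0 | rfl | h0
    · refine hP.not_mem_openSegment h u ⟨β / (β - α), -α / (β - α), div_pos (by linarith)
        (by linarith), div_pos (by linarith) (by linarith), ?_, ?_⟩
      · rw [← add_div]; exact div_self (by linarith)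
      · have : β - α ≠ 0 := by linarith
        rw [ev, ew]
        apply plane_ext <;> simp only [PiLp.add_apply, PiLp.smul_apply, PiLp.sub_apply,
          smul_eq_mul] <;> field_simp <;> ring
    · rw [zero_smul, add_zero] at ev
      exact huv (hP.simple.injective ev).symm
    · have hxw : x ∈ openSegment ℝ (P u) (P w) := by
        have := ray_mem_openSegment (P u) x one_pos hβ
        rwa [← ew, one_smul, add_sub_cancel] at this
      refine hP.not_mem_openSegment (v := u) (w := w) ⟨huw, ?_⟩ v ?_
      · refine (segment_subset_union hxw).trans (Set.union_subset hA (Set.Subset.trans ?_ h.2))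
        exact (convex_segment _ _).segment_subset (openSegment_subset_segment _ _ _ hx)
          (right_mem_segment _ _ _)
      · rw [ev, ew]
        exact ray_mem_openSegment (P u) x h0 (hα.trans hβ)
  obtain ⟨α, ev⟩ := exists_ray hux h0.1
  obtain ⟨β, ew⟩ := exists_ray hux h0.2
  obtain ⟨s, t, hs, ht, hst, e⟩ := hx
  have h1 : s * α + t * β = 1 := by
    have h2 : (s * α + t * β - 1) • (x - P u) = 0 := by
      have e' : (s * α + t * β - 1) • (x - P u) =
          (s • (P u + α • (x - P u)) + t • (P u + β • (x - P u))) - x - (s + t - 1) • P u := by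
        module
      rw [e', ← ev, ← ew, e, hst]; simp
    rcases smul_eq_zero.1 h2 with h2 | h2
    · linarith
    · exact absurd (sub_eq_zero.1 h2).symm hux
  have hx' : x ∈ openSegment ℝ (P v) (P w) := ⟨s, t, hs, ht, hst, e⟩
  rcases lt_trichotomy α 1 with hα | rfl | hα
  · refine key h huv huw hx' α β ev ew hα ?_
    by_contra! hn
    nlinarith
  · have hβ : β = 1 := by
      have : t * (β - 1) = 0 := by linarith
      rcases mul_eq_zero.1 this with h | h <;> linarith
    subst hβ
    exact h.1 (hP.simple.injective (ev.trans ew.symm))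
  · refine key h.symm huw huv (by rwa [openSegment_symm]) β α ew ev ?_ hα
    by_contra! hn
    nlinarith

/-- The first triangle on the way from a vertex `v` to a point `x`. -/
lemma IsTriangulation.exists_tri_towards (hP : IsDeflated P) (hT : IsTriangulation P T)
    {v : Fin n} {x : Plane} (hA : segment ℝ (P v) x ⊆ closedRegion P) :
    ∃ a b, Tri P T v a b ∧ orient (P v) x (P a) ≤ 0 ∧ 0 ≤ orient (P v) x (P b) := by
  have hev : ∀ᶠ ε in nhdsWithin (0 : ℝ) (Set.Ioi 0), P v + ε • (x - P v) ∈ closedRegion P := by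
    have : Set.Ioo (0 : ℝ) 1 ∈ nhdsWithin (0 : ℝ) (Set.Ioi 0) := Ioo_mem_nhdsGT one_pos
    filter_upwards [this] with ε hε
    refine hA ?_
    have := ray_mem_segment (P v) x hε.1.le hε.2.le
    rwa [one_smul, add_sub_cancel] at this
  obtain ⟨a, b, c, h, hv, ε, hε, hx⟩ := hT.exists_tri_of_eventually hP hev
  have key : ∀ {a b : Fin n}, Tri P T v a b → P v + ε • (x - P v) ∈ hull P {v, a, b} →
      ∃ a b, Tri P T v a b ∧ orient (P v) x (P a) ≤ 0 ∧ 0 ≤ orient (P v) x (P b) := by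
    intro a b h hx
    obtain ⟨h1, -, h3⟩ := h.mem_hull.1 hx
    rw [orient_ray, orient_self_left] at h1
    rw [orient_ray, orient_self_right] at h3
    refine ⟨a, b, h, ?_, ?_⟩
    · rw [orient_swap_right]
      by_contra! hn
      nlinarith
    · rw [orient_rotate (P b)]
      by_contra! hn
      nlinarith
  rcases h.vertex_of_mem hP hT hv with rfl | rfl | rfl
  · exact key h hx
  · exact key h.rotate (by rw [rotate_eq]; exact hx)
  · exact key h.rotate.rotate (by rw [rotate_eq, rotate_eq]; exact hx)

/-- A sight line that touches the vertex `v` joined to `u` in the triangulation gives a visibility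
path: turn around `v` from the edge `u v` to the triangle that the sight line enters at `v`. -/
lemma exists_leads_of_touch {u v g : Fin n} {r : ℝ} (hP : IsDeflated P) (hT : IsTriangulation P T)
    (hvu : Nbr P T v u) (hr : 1 < r)
    (hx : P u + r • (P v - P u) ∈ openSegment ℝ (P g) (P (finRotate n g)))
    (hA : segment ℝ (P u) (P u + r • (P v - P u)) ⊆ closedRegion P)
    (hg : orient (P u) (P v) (P g) ≠ orient (P u) (P v) (P (finRotate n g))) :
    ∃ (t : {t // t ∈ T}) (b : Node T), u ∈ t.1 ∧
      (directedDual P T).Leads (Sum.inl t) b (Sum.inr g) := by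
  have hadj : (visibilityGraph P).Adj u v := by
    obtain ⟨b, h | h⟩ := hvu
    · exact (h.adj hT).symm
    · exact h.rotate.rotate.adj hT
  have huv : P u ≠ P v := fun e => hadj.1 (hP.simple.injective e)
  have hvray : P v ∈ openSegment ℝ (P u) (P u + r • (P v - P u)) := by
    have := ray_mem_openSegment (P u) (P v) one_pos hr
    rwa [one_smul, add_sub_cancel] at this
  have hclear : Clear P u (P v) := by
    intro y s hs e hyA
    have hmem : P v ∈ openSegment ℝ (P u) (P y) := by
      have := ray_mem_openSegment (P u) (P v) one_pos hs
      rwa [← e, one_smul, add_sub_cancel] at this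
    refine hP.not_mem_openSegment (v := u) (w := y) ⟨?_, hyA⟩ v hmem
    rintro rfl
    rw [openSegment_same, Set.mem_singleton_iff] at hmem
    exact huv hmem.symm
  have hfu : orient (P u) (P v) (P u) = 0 := orient_self_left _ _
  have hfv : orient (P u) (P v) (P v) = 0 := orient_self_right _ _
  -- If no path exists, no edge opposite the corner `u` is good. This failure, carried from triangle
  -- to triangle around `v`, keeps the turn on one side of the ray, although it must arrive at a
  -- vertex on the other side.
  by_contra hno
  have hnot : ∀ {p q : Fin n} (h : Tri P T u p q), ¬ Good P T (Sum.inr g) h := by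
    intro p q h hgood
    obtain ⟨b, hb⟩ := hgood.exists_leads hP hT
    exact hno ⟨_, b, by simp, hb⟩
  -- the triangle that the ray enters at `v`
  obtain ⟨a, b, hab, ha, hb⟩ : ∃ a b, Tri P T v a b ∧ orient (P u) (P v) (P a) < 0 ∧
      0 < orient (P u) (P v) (P b) := by
    obtain ⟨a, b, h, ha, hb⟩ := hT.exists_tri_towards hP (v := v)
      (x := P u + r • (P v - P u)) (((convex_segment _ _).segment_subset
        (openSegment_subset_segment _ _ _ hvray) (right_mem_segment _ _ _)).trans hA)
    have e : ∀ y, orient (P v) (P u + r • (P v - P u)) y = (r - 1) * orient (P u) (P v) y := by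
      intro y
      simp only [orient, PiLp.add_apply, PiLp.smul_apply, PiLp.sub_apply, smul_eq_mul]; ring
    rw [e] at ha hb
    have ha' : orient (P u) (P v) (P a) ≤ 0 := by
      by_contra! hn
      nlinarith
    have hb' : 0 ≤ orient (P u) (P v) (P b) := by
      by_contra! hn
      nlinarith
    -- A neighbour of `v` on the line is not behind `v`, since `u` would see it through `v`. Hence
    -- neither `a` nor `b` is on the line.
    have hzero : ∀ y : Fin n, (visibilityGraph P).Adj v y → orient (P u) (P v) (P y) = 0 →
        ∃ s ≤ (1 : ℝ), P y = P u + s • (P v - P u) := by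
      intro y hvy h0
      obtain ⟨s, hs⟩ := exists_ray huv h0
      refine ⟨s, ?_, hs⟩
      by_contra! hn
      refine hclear y s hn hs ?_
      have := ray_mem_openSegment (P u) (P v) one_pos hn
      rw [← hs, one_smul, add_sub_cancel] at this
      exact (segment_subset_union this).trans (Set.union_subset hadj.2 hvy.2)
    have ho := h.2
    have hexp : ∀ (s : ℝ) (y : Plane), orient (P v) (P u + s • (P v - P u)) y =
        (s - 1) * orient (P u) (P v) y := by
      intro s y
      simp only [orient, PiLp.add_apply, PiLp.smul_apply, PiLp.sub_apply, smul_eq_mul]; ring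
    refine ⟨a, b, h, lt_of_le_of_ne ha' fun h0 => ?_, lt_of_le_of_ne hb' fun h0 => ?_⟩
    · obtain ⟨s, hs, e⟩ := hzero a (h.adj hT) h0
      rw [e, hexp] at ho
      nlinarith
    · obtain ⟨s, hs, e⟩ := hzero b (h.rotate.rotate.adj hT).symm h0.symm
      rw [orient_swap_right, e, hexp] at ho
      nlinarith
  have hsee : ∃ s : ℝ, 1 ≤ s ∧ P u + s • (P v - P u) = P v ∧
      segment ℝ (P u) (P u + s • (P v - P u)) ⊆ closedRegion P := by
    refine ⟨1, le_rfl, ?_, ?_⟩ <;> rw [one_smul, add_sub_cancel]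
    exact hadj.2
  obtain ⟨s, hs, hsv, hsA⟩ := hsee
  obtain ⟨e, he⟩ := hT.exists_fan hP v
  have huniq : Relator.RightUnique (Tri P T v) := fun _ _ _ h h' => h.unique h' hT
  -- The triangles at `v` form a single fan, so turning counter-clockwise leads from `u` to `a` or
  -- from `a` to `u`.
  rcases Relation.ReflTransGen.total_of_right_unique huniq (he u hvu) (he a ⟨b, Or.inl hab⟩)
    with hch | hch
  · -- counter-clockwise from `u` to `a`, on the right-hand side of the ray
    have key : ∀ x, Relation.ReflTransGen (Tri P T v) u x → x = u ∨
        (orient (P u) (P v) (P x) < 0 ∧ ∃ (z : Fin n) (h : Sight P T u (P v) z x v),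
          ¬ Good P T (Sum.inr g) h.tri) := by
      intro x hx'
      induction hx' with
      | refl => exact Or.inl rfl
      | @tail x x' _ hxx' ih =>
        right
        rcases ih with rfl | ⟨hfx, z, h, hng⟩
        · have hlt : orient (P x) (P v) (P x') < 0 := by
            rw [orient_swap]; have := hxx'.2; linarith
          exact ⟨hlt, x, ⟨hxx'.rotate, by rw [hfu]; exact hlt.le, by rw [hfu, hfv], hlt.le, hfv.ge,
            by rw [hfv]; exact hlt, s, hs, by rw [hsv]; exact right_mem_segment _ _ _, hsA⟩,
            hnot _⟩
        · have h' : Tri P T x x' v := hxx'.rotate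
          rcases h.next h' hP hT hclear with ⟨h0, h1, -, h3, h4⟩ | ⟨h0, h1, -, h3, h4⟩
          · exact ⟨h0, x, h4, fun hgood => hng (h.tri.good_step h' hP hT (Or.inr ⟨h1, hgood⟩))⟩
          -- With `x'` on the left, the ray would pass strictly through `x x'`. That edge is good by
          -- `Sight.good`, and so would be the edge before it.
          · refine absurd (h.tri.good_step h' hP hT (Or.inl ⟨h1, ?_⟩)) hng
            exact Sight.good hP hT hclear (by linarith) hx hA hg (x, x') v h4 hfx h0
    rcases key b (hch.tail hab) with rfl | ⟨h, -⟩
    · exact hb.ne' hfu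
    · exact h.not_gt hb
  · -- clockwise from `u` to `b`, on the left-hand side of the ray
    have key : ∀ x, Relation.ReflTransGen (Tri P T v) x u → x = u ∨
        (0 < orient (P u) (P v) (P x) ∧ ∃ (z : Fin n) (h : Sight P T u (P v) z v x),
          ¬ Good P T (Sum.inr g) h.tri) := by
      intro x hx'
      induction hx' using Relation.ReflTransGen.head_induction_on with
      | refl => exact Or.inl rfl
      | @head x' x hxx' _ ih =>
        right
        rcases ih with rfl | ⟨hfx, z, h, hng⟩
        · have hlt : 0 < orient (P x) (P v) (P x') := by
            have := hxx'.rotate.rotate.2; exact this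
          exact ⟨hlt, x, ⟨hxx'.rotate.rotate, by rw [hfu, hfv], by rw [hfu]; exact hlt.le, hfv.le,
            hlt.le, by rw [hfv]; exact hlt, s, hs, by rw [hsv]; exact left_mem_segment _ _ _, hsA⟩,
            hnot _⟩
        · have h' : Tri P T v x' x := hxx'
          rcases h.next h' hP hT hclear with ⟨h0, h1, -, h3, h4⟩ | ⟨h0, h1, -, h3, h4⟩
          · refine absurd (h.tri.good_step h' hP hT (Or.inr ⟨h1, ?_⟩)) hng
            exact Sight.good hP hT hclear (by linarith) hx hA hg (x', x) v h4 h0 hfx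
          · exact ⟨h0, x, h4, fun hgood => hng (h.tri.good_step h' hP hT (Or.inl ⟨h1, hgood⟩))⟩
    rcases key a hch with rfl | ⟨h, -⟩
    · exact ha.ne hfu
    · exact h.not_gt ha

/-- Every edge visible from `u` is reached by a visibility path from a triangle with corner
`u`. -/
theorem exists_leads_of_seesEdge (hP : IsDeflated P) (hT : IsTriangulation P T) {u g : Fin n}
    (h : SeesEdge P u g) : ∃ (t : {t // t ∈ T}) (b : Node T), u ∈ t.1 ∧
      (directedDual P T).Leads (Sum.inl t) b (Sum.inr g) := by
  by_cases hug : u = g ∨ u = finRotate n g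
  · have key : ∀ {a b c : Fin n} (h : Tri P T a b c), s(a, b) = s(g, finRotate n g) →
        ∃ (t : {t // t ∈ T}) (b : Node T), u ∈ t.1 ∧
          (directedDual P T).Leads (Sum.inl t) b (Sum.inr g) := by
      intro a b c h e
      refine ⟨⟨{a, b, c}, h.1⟩, Sum.inr g, ?_, .last _ _ h.node_not_terminal
        ⟨Sum.inl_ne_inr, s(a, b), h.mem_nodeEdges, e⟩ ⟨g, rfl⟩⟩
      have hu : u ∈ s(a, b) := by rw [e, Sym2.mem_iff]; exact hug
      rcases Sym2.mem_iff.1 hu with rfl | rfl <;> simp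
    rcases hT.exists_tri_edge hP g with ⟨c, hc⟩ | ⟨c, hc⟩
    · exact key hc rfl
    · exact key hc Sym2.eq_swap
  push Not at hug
  obtain ⟨x, hx, hA⟩ := h
  have hadjg := hP.simple.adj_succ g
  have hg := hP.not_collinear hadjg hug.1 hug.2 hx hA
  have hux : P u ≠ x := fun e => hP.not_mem_openSegment hadjg u (e ▸ hx)
  obtain ⟨a, b, hab, ha, hb⟩ := hT.exists_tri_towards hP hA
  have hxB : x ∈ P.boundary ℝ := edgeSet_subset_boundary P g
    (by rw [edgeSet_eq]; exact openSegment_subset_segment _ _ _ hx)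
  -- rescaling the ray
  have hscale : ∀ {c : Plane} {s : ℝ}, 0 < s → c = P u + s • (x - P u) →
      x = P u + s⁻¹ • (c - P u) ∧ ∀ y, orient (P u) c y = s * orient (P u) x y := by
    rintro c s hs rfl
    refine ⟨?_, fun y => ?_⟩
    · rw [add_sub_cancel_left, smul_smul, inv_mul_cancel₀ hs.ne', one_smul, add_sub_cancel]
    · simp only [orient, PiLp.add_apply, PiLp.smul_apply, PiLp.sub_apply, smul_eq_mul]; ring
  -- the case that the ray runs along an edge at `u`
  have touch : ∀ v : Fin n, (visibilityGraph P).Adj u v → Nbr P T v u →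
      (∃ s : ℝ, 0 < s ∧ P v = P u + s • (x - P u)) →
      ∃ (t : {t // t ∈ T}) (b : Node T), u ∈ t.1 ∧
        (directedDual P T).Leads (Sum.inl t) b (Sum.inr g) := by
    rintro v hadj hnbr ⟨s, hs, hv⟩
    obtain ⟨hxv, hor⟩ := hscale hs hv
    -- `v` comes before `x`: otherwise it would lie on the open edge `g`, or `u v` would cross that
    -- edge.
    have hs1 : s < 1 := by
      by_contra! hn
      rcases hn.eq_or_lt with rfl | hn
      · rw [one_smul, add_sub_cancel] at hv
        exact hP.not_mem_openSegment hadjg v (hv ▸ hx)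
      · have hxo : x ∈ openSegment ℝ (P u) (P v) := by
          have := ray_mem_openSegment (P u) x one_pos hn
          rwa [← hv, one_smul, add_sub_cancel] at this
        refine Set.disjoint_left.1 (hP.no_crossing _ _ _ _ hadj hadjg ?_) hxo hx
        intro e
        rcases Sym2.eq_iff.1 e with ⟨e, -⟩ | ⟨e, -⟩
        · exact hug.1 e
        · exact hug.2 e
    refine exists_leads_of_touch hP hT hnbr (r := s⁻¹) ((one_lt_inv₀ hs).2 hs1) ?_ ?_ ?_
    · rwa [← hxv]
    · rwa [← hxv]
    · rw [hor, hor]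
      exact fun e => hg (mul_left_cancel₀ hs.ne' e)
  have hexp : ∀ (s : ℝ) (y : Plane), orient (P u) (P u + s • (x - P u)) y =
      s * orient (P u) x y := by
    intro s y
    simp only [orient, PiLp.add_apply, PiLp.smul_apply, PiLp.sub_apply, smul_eq_mul]; ring
  have ho := hab.2
  rcases ha.eq_or_lt with ha0 | ha'
  · refine touch a (hab.adj hT) ⟨b, Or.inr hab.rotate⟩ ?_
    obtain ⟨s, hs⟩ := exists_ray hux ha0
    refine ⟨s, ?_, hs⟩
    rw [hs, hexp] at ho
    by_contra! hn
    nlinarith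
  rcases hb.eq_or_lt with hb0 | hb'
  · refine touch b (hab.rotate.rotate.adj hT).symm ⟨a, Or.inl hab.rotate.rotate⟩ ?_
    obtain ⟨s, hs⟩ := exists_ray hux hb0.symm
    refine ⟨s, ?_, hs⟩
    rw [orient_swap_right, hs, hexp] at ho
    by_contra! hn
    nlinarith
  -- The ray enters the interior of the triangle `u a b`. The point `m` where it meets `a b` becomes
  -- the reference point of the sight line, and `x` then has the parameter `s⁻¹`.
  · obtain ⟨m, hm, hm0⟩ := exists_mem_openSegment_orient_eq_zero (P u) x ha' hb'
    obtain ⟨s, hms⟩ := exists_ray hux hm0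
    have hs : 0 < s := by
      have h1 := orient_of_mem_segment (openSegment_subset_segment _ _ _ hm)
      have h2 := (hab.sight_of_mem hP hT hm).2.1
      rw [hms, hexp] at h2
      by_contra! hn
      nlinarith
    obtain ⟨hxm, hor⟩ := hscale hs hms
    obtain ⟨hsight, hfa, hfb, hclear⟩ := hab.sight_of_mem hP hT hm
    obtain ⟨d, hd⟩ := (Sight.good hP hT hclear (inv_pos.2 hs) (by rwa [← hxm]) (by rwa [← hxm])
      (by rw [hor, hor]; exact fun e => hg (mul_left_cancel₀ hs.ne' e)) (a, b) u hsight hfa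
      hfb).exists_leads hP hT
    exact ⟨_, d, by simp, hd⟩

/-! ### Isomorphisms of directed duals -/

namespace DirectedPlaneGraph

variable {N N' : Type} {D : DirectedPlaneGraph N} {D' : DirectedPlaneGraph N'}

/-- The inverse of an isomorphism. -/
def Iso.symm (φ : D.Iso D') : D'.Iso D where
  toEquiv := φ.toEquiv.symm
  adj_iff x y := by simp [← φ.adj_iff]
  terminal_iff x := by simp [← φ.terminal_iff]
  ccw_iff b x y z := by simp [← φ.ccw_iff]
  arrow_iff x y := by simp [← φ.arrow_iff]

lemma Iso.leads (φ : D.Iso D') {a b g : N} (h : D.Leads a b g) :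
    D'.Leads (φ.toEquiv a) (φ.toEquiv b) (φ.toEquiv g) := by
  induction h with
  | last a b ha hab hb =>
    exact .last _ _ (by rwa [φ.terminal_iff]) ((φ.adj_iff _ _).2 hab) ((φ.terminal_iff _).2 hb)
  | step a b c r l g ha hab hb hc hor _ ih =>
    refine .step _ _ _ _ _ _ (by rwa [φ.terminal_iff]) ((φ.adj_iff _ _).2 hab)
      (by rwa [φ.terminal_iff]) ((φ.ccw_iff _ _ _ _).2 hc) ?_ ih
    rw [φ.arrow_iff, φ.arrow_iff, φ.toEquiv.apply_eq_iff_eq, φ.toEquiv.apply_eq_iff_eq]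
    exact hor

end DirectedPlaneGraph

/-! ### Visibility and vertices read off the directed dual. -/

variable {m : ℕ} {Q : Polygon Plane m}
  {S : Finset (Finset (Fin m))}

theorem seesEdge_iff (hP : IsDeflated P) (hT : IsTriangulation P T) {u g : Fin n} :
    SeesEdge P u g ↔ ∃ (t : {t // t ∈ T}) (b : Node T), u ∈ t.1 ∧
      (directedDual P T).Leads (Sum.inl t) b (Sum.inr g) := by
  refine ⟨exists_leads_of_seesEdge hP hT, ?_⟩
  rintro ⟨t, b, hu, hl⟩
  obtain ⟨i, e, h⟩ := seesEdge_of_leads hP hT hl t rfl hu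
  rwa [Sum.inr.inj e]

/-- The vertex `u` is a corner of the triangle or an endpoint of the edge of a node. -/
def Corner (u : Fin n) (x : Node T) : Prop := ∃ e ∈ nodeEdges x, u ∈ e

lemma corner_inr {u i : Fin n} :
    Corner u (Sum.inr i : Node T) ↔ u = i ∨ u = finRotate n i := by
  constructor
  · rintro ⟨e, rfl, h⟩
    exact Sym2.mem_iff.1 h
  · exact fun h => ⟨_, rfl, Sym2.mem_iff.2 h⟩

lemma corner_inl (hP : IsDeflated P) (hT : IsTriangulation P T) {u : Fin n} {t : {t // t ∈ T}} :
    Corner u (Sum.inl t : Node T) ↔ u ∈ t.1 := by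
  constructor
  · rintro ⟨e, he, h⟩
    exact he.2 u h
  · intro h
    obtain ⟨p, q, e, h'⟩ := hT.exists_tri_corner hP t.2 h
    exact ⟨s(u, p), mem_nodeEdges_inl.2 ⟨h'.ne_left, h, by simp [e]⟩, by simp⟩

/-- The two polygon edges at `u` have no other common endpoint, so their terminal nodes already
determine `u`. -/
lemma eq_of_corner (hn : 3 ≤ n) {u v : Fin n} (h : ∀ x : Node T, Corner u x → Corner v x) :
    v = u := by
  have h1 := corner_inr.1 (h (Sum.inr u) (corner_inr.2 (Or.inl rfl)))
  have h2 := corner_inr.1 (h (Sum.inr ((finRotate n).symm u))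
    (corner_inr.2 (Or.inr (by simp only [Equiv.apply_symm_apply]))))
  rw [Equiv.apply_symm_apply] at h2
  rcases h1 with h1 | h1
  · exact h1
  rcases h2 with h2 | h2
  · refine absurd ?_ (finRotate_finRotate_ne hn u)
    rw [← h1, h2, Equiv.apply_symm_apply]
  · exact h2

/-- The corner `u` of the triangle `u a b` is mapped to `u'`: the nodes across the two edges at `u`
are mapped to nodes across the edges at `u'`. -/
def CornerImage (φ : (directedDual P T).Iso (directedDual Q S)) {u a b : Fin n}
    (h : Tri P T u a b) (u' : Fin m) : Prop :=
  ∃ (a' b' : Fin m) (h' : Tri Q S u' a' b'), φ.toEquiv h.node = h'.node ∧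
    (∀ x, x ≠ h.node → s(u, a) ∈ nodeEdges x → s(u', a') ∈ nodeEdges (φ.toEquiv x)) ∧
    ∀ x, x ≠ h.node → s(u, b) ∈ nodeEdges x → s(u', b') ∈ nodeEdges (φ.toEquiv x)

variable (φ : (directedDual P T).Iso (directedDual Q S))

/-- A corner lies between two consecutive edges of its triangle, and `φ` preserves the cyclic order
of the nodes across them. -/
lemma exists_cornerImage (hP : IsDeflated P) (hT : IsTriangulation P T) {u a b : Fin n}
    (h : Tri P T u a b) : ∃ u', CornerImage φ h u' := by
  obtain ⟨x, hx, ex⟩ := h.exists_across hP hT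
  obtain ⟨z, hz, ez⟩ := h.rotate.exists_across hP hT
  obtain ⟨y, hy, ey⟩ := h.rotate.rotate.exists_across hP hT
  rw [h.node_rotate] at hz
  rw [h.rotate.node_rotate, h.node_rotate] at hy
  obtain ⟨t, p, q, r, e, e', o, -, -, -, h1, -, h3⟩ :=
    (φ.ccw_iff _ _ _ _).2 (h.ccw_intro hx hz hy ex ez ey)
  obtain ⟨t, ht⟩ := t
  obtain rfl : t = {p, q, r} := e'
  refine ⟨p, q, r, ⟨ht, o⟩, e, fun x' hx' ex' => ?_, fun y' hy' ey' => ?_⟩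
  · rwa [h.across_unique hP hT hx' ex' hx ex]
  · rw [Sym2.eq_swap] at ey' ⊢
    rwa [h.rotate.rotate.across_unique hP hT
      (by rwa [h.rotate.node_rotate, h.node_rotate]) ey'
      (by rwa [h.rotate.node_rotate, h.node_rotate]) ey]

lemma Tri.edge_eq {u a b : Fin n} (h : Tri P T u a b) (hT : IsTriangulation P T) {x : Node T}
    (hx : x ≠ h.node) (hb : s(u, b) ∈ nodeEdges x) {e : Sym2 (Fin n)} (he : e ∈ nodeEdges h.node)
    (he' : e ∈ nodeEdges x) : e = s(u, b) := by
  have hb' : s(b, u) ∈ nodeEdges x := by rwa [Sym2.eq_swap]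
  have hx₁ : x ≠ h.rotate.node := by rwa [h.node_rotate]
  have hx₂ : x ≠ h.rotate.rotate.node := by rwa [h.rotate.node_rotate]
  induction e with
  | _ v w =>
    have n1 : s(u, a) ∉ nodeEdges x := fun h' => h.rotate.rotate.not_two_edges hT hx₂ hb' h'
    have n2 : s(a, b) ∉ nodeEdges x := fun h' => h.rotate.not_two_edges hT hx₁ h' hb'
    obtain ⟨hvw, hv, hw⟩ := mem_nodeEdges_inl.1 he
    simp only [Finset.mem_insert, Finset.mem_singleton] at hv hw
    rcases hv with rfl | rfl | rfl <;> rcases hw with rfl | rfl | rfl <;>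
      first
      | rfl
      | exact absurd rfl hvw
      | exact Sym2.eq_swap
      | exact absurd he' n1
      | exact absurd he' n2
      | (rw [Sym2.eq_swap] at he'; first | exact absurd he' n1 | exact absurd he' n2)

/-- The triangles share the edge `u b`, and their images share exactly one edge. If its ends were
matched the other way round, both images would be on the same side of it and coincide; hence the
corner keeps its image. -/
lemma CornerImage.next (hS : IsTriangulation Q S) (hP : IsDeflated P)
    (hT : IsTriangulation P T) {u a b c : Fin n} {h : Tri P T u a b} {u' : Fin m} (hi : CornerImage φ h u')
    (h₂ : Tri P T u b c) : CornerImage φ h₂ u' := by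
  obtain ⟨u'', hi₂⟩ := exists_cornerImage φ hP hT h₂
  suffices u'' = u' by rwa [← this]
  obtain ⟨a', b', h', e, -, hb⟩ := hi
  obtain ⟨p, q, h₂', e₂, hp, -⟩ := hi₂
  have hne : h₂.node ≠ h.node := by
    have := h₂.node_ne_opposite h.rotate.rotate
    rw [h.rotate.node_rotate, h.node_rotate] at this
    exact this.symm
  have hne' : h₂'.node ≠ h'.node := by
    rw [← e, ← e₂]; exact φ.toEquiv.injective.ne hne
  have m1 : s(u', b') ∈ nodeEdges h₂'.node := by
    rw [← e₂]; exact hb _ hne h₂.mem_nodeEdges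
  have m2 : s(u'', p) ∈ nodeEdges h'.node := by
    rw [← e]
    exact hp _ hne.symm (by rw [Sym2.eq_swap]; exact h.mem_nodeEdges₃)
  have heq := h'.edge_eq hS hne' m1 m2 h₂'.mem_nodeEdges
  rcases Sym2.eq_iff.1 heq with ⟨h1, -⟩ | ⟨rfl, rfl⟩
  · exact h1
  · exfalso
    obtain rfl := h₂'.unique h'.rotate.rotate hS
    exact hne' (by rw [← h'.node_rotate, ← h'.rotate.node_rotate])

/-- The image of one corner at `u` is passed on along the fan, so it is the same for all triangles
at `u`. Each polygon edge at `u` lies across an edge of such a triangle. -/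
lemma exists_corner_map (hP : IsDeflated P) (hT : IsTriangulation P T)
    (hS : IsTriangulation Q S) (u : Fin n) :
    ∃ u' : Fin m, ∀ x : Node T, Corner u x → Corner u' (φ.toEquiv x) := by
  obtain ⟨e, he⟩ := hT.exists_fan hP u
  obtain ⟨e₁, h₁⟩ : ∃ e₁, Tri P T u e e₁ := by
    obtain ⟨a, b, h⟩ : ∃ a b, Tri P T u a b := by
      rcases hT.exists_tri_edge hP u with ⟨c, hc⟩ | ⟨c, hc⟩
      · exact ⟨_, _, hc⟩
      · exact ⟨_, _, hc.rotate⟩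
    rcases (he a ⟨b, Or.inl h⟩).cases_head with rfl | ⟨c, hc, -⟩
    · exact ⟨b, h⟩
    · exact ⟨c, hc⟩
  obtain ⟨u', hu'⟩ := exists_cornerImage φ hP hT h₁
  have key : ∀ a, Relation.ReflTransGen (Tri P T u) e a → ∀ b (h : Tri P T u a b),
      CornerImage φ h u' := by
    intro a ha
    induction ha with
    | refl =>
      intro b h
      obtain rfl := h.unique h₁ hT
      exact hu'
    | tail _ h ih => exact fun b hb => (ih _ h).next φ hS hP hT hb
  have all : ∀ {a b} (h : Tri P T u a b), CornerImage φ h u' :=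
    fun {a b} h => key a (he a ⟨b, Or.inl h⟩) b h
  refine ⟨u', fun x hx => ?_⟩
  have across : ∀ {a b : Fin n} (h : Tri P T u a b) (i : Fin n),
      s(u, a) ∈ nodeEdges (Sum.inr i : Node T) ∨ s(u, b) ∈ nodeEdges (Sum.inr i : Node T) →
      Corner u' (φ.toEquiv (Sum.inr i)) := by
    intro a b h i hi
    obtain ⟨a', b', h', -, h2, h3⟩ := all h
    rcases hi with hi | hi
    · exact ⟨_, h2 _ Sum.inr_ne_inl hi, by simp⟩
    · exact ⟨_, h3 _ Sum.inr_ne_inl hi, by simp⟩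
  rcases x with t | i
  · obtain ⟨t, ht⟩ := t
    obtain ⟨p, q, rfl, h⟩ := hT.exists_tri_corner hP ht ((corner_inl hP hT).1 hx)
    obtain ⟨a', b', h', e', -⟩ := all h
    have : Corner u' h'.node := ⟨_, h'.mem_nodeEdges, by simp⟩
    rwa [← e'] at this
  · rcases corner_inr.1 hx with rfl | rfl
    · rcases hT.exists_tri_edge hP u with ⟨c, hc⟩ | ⟨c, hc⟩
      · exact across hc u (Or.inl rfl)
      · exact across hc.rotate u (Or.inr rfl)
    · rcases hT.exists_tri_edge hP i with ⟨c, hc⟩ | ⟨c, hc⟩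
      · exact across hc.rotate i (Or.inr Sym2.eq_swap)
      · exact across hc i (Or.inl Sym2.eq_swap)

/-- An isomorphism of directed duals induces a bijection of the edges. -/
lemma exists_edge_equiv : ∃ τ : Fin n ≃ Fin m, ∀ g, φ.toEquiv (Sum.inr g) = Sum.inr (τ g) := by
  have h : ∀ g : Fin n, ∃ g' : Fin m, φ.toEquiv (Sum.inr g) = Sum.inr g' := by
    intro g
    obtain ⟨g', h⟩ := (φ.terminal_iff (Sum.inr g)).2 ⟨g, rfl⟩
    exact ⟨g', h.symm⟩
  have h' : ∀ g : Fin m, ∃ g' : Fin n, φ.toEquiv (Sum.inr g') = Sum.inr g := by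
    intro g
    obtain ⟨g', h⟩ := (φ.symm.terminal_iff (Sum.inr g)).2 ⟨g, rfl⟩
    exact ⟨g', by rw [h]; exact φ.toEquiv.apply_symm_apply _⟩
  choose τ hτ using h
  refine ⟨Equiv.ofBijective τ ⟨fun a b e => ?_, fun g => ?_⟩, hτ⟩
  · exact Sum.inr.inj (φ.toEquiv.injective (by rw [hτ, hτ, e]))
  · obtain ⟨g', hg'⟩ := h' g
    exact ⟨g', Sum.inr.inj ((hτ g').symm.trans hg')⟩

/-- An isomorphism of directed duals induces a bijection of the vertices. -/
lemma exists_vertex_equiv (hP : IsDeflated P) (hT : IsTriangulation P T) (hQ : IsDeflated Q)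
    (hS : IsTriangulation Q S) :
    ∃ σ : Fin n ≃ Fin m, ∀ u (x : Node T), Corner u x ↔ Corner (σ u) (φ.toEquiv x) := by
  choose σ hσ using exists_corner_map φ hP hT hS
  choose σ' hσ' using exists_corner_map φ.symm hQ hS hT
  have hs : ∀ x, φ.symm.toEquiv (φ.toEquiv x) = x := φ.toEquiv.symm_apply_apply
  have hs' : ∀ x, φ.toEquiv (φ.symm.toEquiv x) = x := φ.toEquiv.apply_symm_apply
  -- A vertex is determined by the nodes it belongs to, so the maps obtained from `φ` and from its
  -- inverse are inverse to each other.
  have l : ∀ u, σ' (σ u) = u := fun u => eq_of_corner (T := T) hP.simple.three_le fun x hx => by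
    have := hσ' _ _ (hσ u x hx)
    rwa [hs] at this
  have r : ∀ u, σ (σ' u) = u := fun u => eq_of_corner (T := S) hQ.simple.three_le fun x hx => by
    have := hσ _ _ (hσ' u x hx)
    rwa [hs'] at this
  refine ⟨⟨σ, σ', l, r⟩, fun u x => ⟨hσ u x, fun h => ?_⟩⟩
  have := hσ' _ _ h
  rw [hs] at this
  rwa [← l u]

lemma seesEdge_map (hP : IsDeflated P) (hT : IsTriangulation P T) (hQ : IsDeflated Q)
    (hS : IsTriangulation Q S) {u g : Fin n} {u' g' : Fin m}
    (hu : ∀ x : Node T, Corner u x → Corner u' (φ.toEquiv x))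
    (hg : φ.toEquiv (Sum.inr g) = Sum.inr g') (h : SeesEdge P u g) : SeesEdge Q u' g' := by
  obtain ⟨t, b, ht, hl⟩ := (seesEdge_iff hP hT).1 h
  have hl' := φ.leads hl
  have hc := hu _ ((corner_inl hP hT).2 ht)
  rw [hg] at hl'
  have hnt : φ.toEquiv (Sum.inl t) ∉ (directedDual Q S).terminal := by
    rw [φ.terminal_iff]
    rintro ⟨i, hi⟩
    exact Sum.inr_ne_inl hi
  rcases hx : φ.toEquiv (Sum.inl t) with t' | i
  · rw [hx] at hl' hc
    exact (seesEdge_iff hQ hS).2 ⟨t', _, (corner_inl hQ hS).1 hc, hl'⟩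
  · exact absurd ⟨i, hx.symm⟩ hnt

end PolyVis

theorem mainTheorem5 {n : ℕ} (P : Polygon PolyVis.Plane n) (hP : PolyVis.IsDeflated P)
    (T : Finset (Finset (Fin n))) (hT : PolyVis.IsTriangulation P T) :
    (∀ u g : Fin n, PolyVis.SeesEdge P u g ↔
      ∃ (t : {t // t ∈ T}) (x : List (PolyVis.Node T)), u ∈ t.1 ∧
        (PolyVis.directedDual P T).IsVisibilityPath x ∧
        x.head? = some (Sum.inl t) ∧ x.getLast? = some (Sum.inr g)) ∧
    (∀ (m : ℕ) (Q : Polygon PolyVis.Plane m), PolyVis.IsDeflated Q →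
      ∀ S : Finset (Finset (Fin m)), PolyVis.IsTriangulation Q S →
      ∀ φ : (PolyVis.directedDual P T).Iso (PolyVis.directedDual Q S),
        ∃ σ τ : Fin n ≃ Fin m,
          (∀ g : Fin n, φ.toEquiv (Sum.inr g) = Sum.inr (τ g)) ∧
          (∀ u g : Fin n, (u = g ∨ u = finRotate n g) ↔
            (σ u = τ g ∨ σ u = finRotate m (τ g))) ∧
          ∀ u g : Fin n, PolyVis.SeesEdge P u g ↔ PolyVis.SeesEdge Q (σ u) (τ g)) := by
  refine ⟨fun u g => ?_, fun m Q hQ S hS φ => ?_⟩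
  · rw [PolyVis.seesEdge_iff hP hT]
    refine exists_congr fun t => ?_
    rw [exists_and_left, exists_and_left,
      PolyVis.DirectedPlaneGraph.exists_path_iff PolyVis.directedDual_ccw_adj]
  · obtain ⟨τ, hτ⟩ := PolyVis.exists_edge_equiv φ
    obtain ⟨σ, hσ⟩ := PolyVis.exists_vertex_equiv φ hP hT hQ hS
    refine ⟨σ, τ, hτ, fun u g => ?_, fun u g => ⟨?_, ?_⟩⟩
    · rw [← PolyVis.corner_inr (T := T), hσ, hτ, PolyVis.corner_inr]
    · exact PolyVis.seesEdge_map φ hP hT hQ hS (fun x => (hσ u x).1) (hτ g)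
    · refine PolyVis.seesEdge_map φ.symm hQ hS hP hT (fun x hx => ?_) ?_
      · rw [hσ, show φ.toEquiv (φ.symm.toEquiv x) = x from φ.toEquiv.apply_symm_apply x]
        exact hx
      · rw [← hτ]; exact φ.toEquiv.symm_apply_apply _
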